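/- Let $w\in S_n$ be a vexillary (i.e. $2143$-avoiding) permutation. **Notation.** The Rothe diagram of $w$ is $D(w)=\{(i,j)\in[n]\times[n]: i<w^{-1}(j),\ j<w(i)\}$ ($i$ is the row, numbered from top to bottom, $j$ the column), and $r_{D(w)}(i,j)=\#\{k<i: w(k)<j\}$ is the rank of $(i,j)\in D(w)$. A *bubbling diagram* is a triple $\mathcal D=(D,r,F)$ with $F\subseteq D\subseteq[n]\times[n]$ and $r\colon D\to\mathbb Z_{\ge0}$ such that (a) for each $(i,j)\in F$ there is $i'<i$ with $(i',j)\in D\setminus F$, and for the largest such $i'$ one has $r(i,j)-r(i',j)=i-i'$; (b) $r(i,j)\ne r(i,k)$ whenever $(i,j),(i,k)\in F$ and $j\neq k$. Squares in $D\setminus F$ are *live*, squares in $F$ *dead*, squares not in $D$ *empty*. The weight $\mathrm{wt}(D)\in\mathbb Z^n$ has as $i$-th entry the number of squares of $D$ in row $i$. If $(i,j)$ is live, $i>1$, and $(i-1,j)$ is empty, a *bubbling move* at $(i,j)$ replaces $(i,j)$ by the live square $(i-1,j)$ of rank $r(i,j)-1$. If moreover no dead square in row $i$ has rank $r(i,j)$,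 a *K-bubbling move* at $(i,j)$ adds the live square $(i-1,j)$ of rank $r(i,j)-1$ and makes $(i,j)$ dead, with unchanged rank. All other squares and ranks are unchanged. Let $\mathcal{BD}(w)$ be the set of bubbling diagrams obtained from $(D(w),r_{D(w)},\emptyset)$ by sequences of bubbling and K-bubbling moves. Order $D(w)$ by: $(i,j)\prec(i',j')$ if $i>i'$; or $i=i'$ and column $j$ of $D(w)$ has fewer squares below row $i$ than column $j'$ does; or $i=i'$, these numbers are equal, and $j<j'$. Two squares $(i,j),(i',j')$ of $D(w)$ are *linked* if $i-i'=r_{D(w)}(i,j)-r_{D(w)}(i',j')$. Let $A(w)$ be obtained by going through $D(w)$ in the order $\prec$ and selecting a square if and only if no square in its column and no square linked to it has been selected before. For $\mathcal D\in\mathcal{BD}(w)$, the *distinguished live squares* of $\mathcal D$ are, for each $a\in A(w)$, say the $m$-th highest square of $D(w)$ in column $j$, the $m$-th highest live square of $\mathcal D$ in column $j$. Let $\mathcal D^\top(w)=(D^\top(w),r^\top_{D(w)},F^\top(w))$ be obtained from $(D(w),r_{D(w)},\emptyset)$ by applying bubbling moves to squares lying above a distinguished live square of the same column until this is no longer possible,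 and then applying K-bubbling moves to distinguished live squares until this is no longer possible. **Theorem.** The bubbling diagram $\mathcal D^\top(w)$ is well defined: the procedure has a result, and it does not depend on the choices made. For any $\mathcal D=(D,r,F)\in\mathcal{BD}(w)$, there is $\mathcal D'=(D',r',F')\in\mathcal{BD}(w)$ with $F'=F^\top(w)$ and $x^{\mathrm{wt}(D)}\mid x^{\mathrm{wt}(D')}$. -/

import Mathlib

/-- A permutation is vexillary if it avoids the pattern `2143`. -/
def Vexillary {n : ℕ} (w : Equiv.Perm (Fin n)) : Prop :=
  ∀ i j k l : Fin n, i < j → j < k → k < l → ¬ (w j < w i ∧ w i < w l ∧ w l < w k)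

/-- A square `(i, j)`: row `i` (rows are numbered from top to bottom), column `j`. Indices start
at `0`. -/
abbrev Square (n k : ℕ) := Fin n × Fin k

/-- A bubbling diagram `(D, r, F)` in the `n × k` grid. The rank function is a function on `D`;
it is stored as a function on the whole grid which is `0` off `D`, so that two
bubbling diagrams are equal exactly when their `D`, their `F` and their ranks on `D` agree. -/
structure BubblingDiagram (n k : ℕ) where
  /-- all squares of the diagram -/
  D : Finset (Square n k)
  /-- the rank function -/
  r : Square n k → ℕ
  /-- the dead squares -/
  F : Finset (Square n k)
  r_off : ∀ x, x ∉ D → r x = 0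
  F_subset : F ⊆ D
  /-- Above a dead square there is a live square in the same column, and the lowest such live
  square has rank smaller by the difference of the rows. -/
  dead_below_live : ∀ i j, (i, j) ∈ F →
    ∃ i', i' < i ∧ (i', j) ∈ D \ F ∧ (∀ i'', i' < i'' → i'' < i → (i'', j) ∉ D \ F) ∧
      (r (i, j) : ℤ) - (r (i', j) : ℤ) = ((i : ℕ) : ℤ) - ((i' : ℕ) : ℤ)
  /-- Two different dead squares in the same row have different ranks. -/
  dead_rank_ne : ∀ i j j', j ≠ j' → (i, j) ∈ F → (i, j') ∈ F → r (i, j) ≠ r (i, j')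

namespace BubblingDiagram

variable {n k : ℕ}

/-- The live squares. -/
def live (𝒟 : BubblingDiagram n k) : Finset (Square n k) := 𝒟.D \ 𝒟.F

/-- The weight of a bubbling diagram: the `i`-th entry is the number of squares (live or dead)
in row `i`. -/
noncomputable def wt (𝒟 : BubblingDiagram n k) : Fin n →₀ ℕ :=
  Finsupp.equivFunOnFinite.symm fun i => (𝒟.D.filter fun x => x.1 = i).card

/-- `𝒟'` is obtained from `𝒟` by a bubbling move at the live square `(i, j)`; here `i'` is the
row directly above row `i`. -/
def BubblingMove (𝒟 : BubblingDiagram n k) (i : Fin n) (j : Fin k)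
    (𝒟' : BubblingDiagram n k) : Prop :=
  (i, j) ∈ 𝒟.live ∧ ∃ i' : Fin n, (i' : ℕ) + 1 = (i : ℕ) ∧ (i', j) ∉ 𝒟.D ∧
    𝒟'.D = insert (i', j) (𝒟.D.erase (i, j)) ∧
    𝒟'.r (i', j) + 1 = 𝒟.r (i, j) ∧
    (∀ x ∈ 𝒟'.D, x ≠ (i', j) → 𝒟'.r x = 𝒟.r x) ∧
    𝒟'.F = 𝒟.F

/-- `𝒟'` is obtained from `𝒟` by a K-bubbling move at the live square `(i, j)`; here `i'` is the
row directly above row `i`. -/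
def KBubblingMove (𝒟 : BubblingDiagram n k) (i : Fin n) (j : Fin k)
    (𝒟' : BubblingDiagram n k) : Prop :=
  (i, j) ∈ 𝒟.live ∧ (∀ l : Fin k, (i, l) ∈ 𝒟.F → 𝒟.r (i, j) ≠ 𝒟.r (i, l)) ∧
    ∃ i' : Fin n, (i' : ℕ) + 1 = (i : ℕ) ∧ (i', j) ∉ 𝒟.D ∧
      𝒟'.D = insert (i', j) 𝒟.D ∧
      𝒟'.r (i', j) + 1 = 𝒟.r (i, j) ∧
      (∀ x ∈ 𝒟'.D, x ≠ (i', j) → 𝒟'.r x = 𝒟.r x) ∧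
      𝒟'.F = insert (i, j) 𝒟.F

/-- One move of either kind. -/
def Move (𝒟 𝒟' : BubblingDiagram n k) : Prop :=
  ∃ i j, BubblingMove 𝒟 i j 𝒟' ∨ KBubblingMove 𝒟 i j 𝒟'

/-- All bubbling diagrams generated from `𝒟` by a series of bubbling and K-bubbling moves. -/
def BD (𝒟 : BubblingDiagram n k) : Set (BubblingDiagram n k) :=
  {𝒟' | Relation.ReflTransGen Move 𝒟 𝒟'}

end BubblingDiagram

/-- The Rothe diagram `{(i, j) : i < w⁻¹(j), j < w(i)}`. -/
def rotheDiagram {n : ℕ} (w : Equiv.Perm (Fin n)) : Finset (Square n n) :=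
  Finset.univ.filter fun x => x.1 < w.symm x.2 ∧ x.2 < w x.1

/-- The rank of a square `(i, j)` with respect to `w`: the number of `k < i` with `w(k) < j`. -/
def rotheRank {n : ℕ} (w : Equiv.Perm (Fin n)) (x : Square n n) : ℕ :=
  (Finset.univ.filter fun k : Fin n => k < x.1 ∧ w k < x.2).card

/-- The Rothe bubbling diagram `(D(w), r_{D(w)}, ∅)`. -/
def rotheBubblingDiagram {n : ℕ} (w : Equiv.Perm (Fin n)) : BubblingDiagram n n where
  D := rotheDiagram w
  r x := if x ∈ rotheDiagram w then rotheRank w x else 0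
  F := ∅
  r_off x hx := by simp [hx]
  F_subset := by simp
  dead_below_live := by simp
  dead_rank_ne := by simp

/-- The set `BD(w)` of bubbling diagrams of `w`. -/
def bubblingDiagrams {n : ℕ} (w : Equiv.Perm (Fin n)) : Set (BubblingDiagram n n) :=
  (rotheBubblingDiagram w).BD

/-- Two squares of the Rothe diagram are linked if the difference of their rows is the
difference of their ranks. -/
def RotheLinked {n : ℕ} (w : Equiv.Perm (Fin n)) (x y : Square n n) : Prop :=
  ((x.1 : ℕ) : ℤ) - ((y.1 : ℕ) : ℤ) = (rotheRank w x : ℤ) - (rotheRank w y : ℤ)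

instance {n : ℕ} (w : Equiv.Perm (Fin n)) (x y : Square n n) : Decidable (RotheLinked w x y) :=
  inferInstanceAs (Decidable (_ = _))

/-- The number of squares of `D(w)` below `x` in the column of `x`. -/
def numBelow {n : ℕ} (w : Equiv.Perm (Fin n)) (x : Square n n) : ℕ :=
  ((rotheDiagram w).filter fun y => y.2 = x.2 ∧ x.1 < y.1).card

/-- The order `≺` on squares: lower rows first; in a row, squares with fewer squares below them
first; ties are broken from left to right. -/
def Prec {n : ℕ} (w : Equiv.Perm (Fin n)) (x y : Square n n) : Prop :=
  y.1 < x.1 ∨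
  (x.1 = y.1 ∧ numBelow w x < numBelow w y) ∨
  (x.1 = y.1 ∧ numBelow w x = numBelow w y ∧ x.2 < y.2)

/-- The reflexive closure of `≺`. -/
def PrecEq {n : ℕ} (w : Equiv.Perm (Fin n)) (x y : Square n n) : Prop := x = y ∨ Prec w x y

instance {n : ℕ} (w : Equiv.Perm (Fin n)) : DecidableRel (PrecEq w) := fun x y =>
  inferInstanceAs (Decidable (x = y ∨ (y.1 < x.1 ∨ (x.1 = y.1 ∧ numBelow w x < numBelow w y) ∨
    (x.1 = y.1 ∧ numBelow w x = numBelow w y ∧ x.2 < y.2))))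

instance {n : ℕ} (w : Equiv.Perm (Fin n)) : IsTrans (Square n n) (PrecEq w) where
  trans := by
    rintro ⟨a, a'⟩ ⟨b, b'⟩ ⟨c, c'⟩ h₁ h₂
    simp only [PrecEq, Prec, Prod.mk.injEq] at *
    grind

instance {n : ℕ} (w : Equiv.Perm (Fin n)) : Std.Antisymm (PrecEq w) where
  antisymm := by
    rintro ⟨a, a'⟩ ⟨b, b'⟩ h₁ h₂
    simp only [PrecEq, Prec, Prod.mk.injEq] at *
    grind

instance {n : ℕ} (w : Equiv.Perm (Fin n)) : Std.Total (PrecEq w) where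
  total := by
    rintro ⟨a, a'⟩ ⟨b, b'⟩
    simp only [PrecEq, Prec, Prod.mk.injEq]
    grind

/-- One step of the greedy selection: append `x` to the list `A` unless `A` already contains a
square in the same column or in the same linking class. -/
def selectStep {n : ℕ} (w : Equiv.Perm (Fin n)) (A : List (Square n n)) (x : Square n n) :
    List (Square n n) :=
  if ∃ a ∈ A, a.2 = x.2 ∨ RotheLinked w a x then A else A ++ [x]

/-- The ordered set `A(w)` of distinguished live squares: go through `D(w)` in the order `≺` and
select greedily. -/
def distinguishedSquares {n : ℕ} (w : Equiv.Perm (Fin n)) : List (Square n n) :=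
  ((rotheDiagram w).sort (PrecEq w)).foldl (selectStep w) []

/-- The position, counted from the top, of a square `x ∈ S` among the squares of `S` in the
column of `x` (the highest one has position `1`). -/
def heightIndex {n k : ℕ} (S : Finset (Square n k)) (x : Square n k) : ℕ :=
  (S.filter fun y => y.2 = x.2 ∧ y.1 ≤ x.1).card

/-- `x ∈ A(𝒟)`: for some `a ∈ A(w)`, say the `m`-th highest square of `D(w)` in its column, `x` is
the `m`-th highest live square of `𝒟` in that column. -/
def IsDistinguished {n : ℕ} (w : Equiv.Perm (Fin n)) (𝒟 : BubblingDiagram n n)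
    (x : Square n n) : Prop :=
  x ∈ 𝒟.live ∧ ∃ a ∈ distinguishedSquares w, a.2 = x.2 ∧
    heightIndex 𝒟.live x = heightIndex (rotheDiagram w) a

/-- A bubbling move at a square lying above a distinguished live square (of the same column). -/
def TopBubblingStep {n : ℕ} (w : Equiv.Perm (Fin n)) (𝒟 𝒟' : BubblingDiagram n n) : Prop :=
  ∃ i j, (∃ i₀, i < i₀ ∧ IsDistinguished w 𝒟 (i₀, j)) ∧ 𝒟.BubblingMove i j 𝒟'

/-- A K-bubbling move at a distinguished live square. -/
def TopKBubblingStep {n : ℕ} (w : Equiv.Perm (Fin n)) (𝒟 𝒟' : BubblingDiagram n n) : Prop :=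
  ∃ i j, IsDistinguished w 𝒟 (i, j) ∧ 𝒟.KBubblingMove i j 𝒟'

/-- `𝒯` is a result of the construction of `𝒟^⊤(w)`: start from the Rothe bubbling diagram, apply
bubbling moves to squares above distinguished live squares until this is no longer possible, and
then K-bubbling moves to distinguished live squares until this is no longer possible. -/
def IsTopDiagram {n : ℕ} (w : Equiv.Perm (Fin n)) (𝒯 : BubblingDiagram n n) : Prop :=
  ∃ ℰ : BubblingDiagram n n,
    Relation.ReflTransGen (TopBubblingStep w) (rotheBubblingDiagram w) ℰ ∧
    (∀ 𝒟', ¬ TopBubblingStep w ℰ 𝒟') ∧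
    Relation.ReflTransGen (TopKBubblingStep w) ℰ 𝒯 ∧
    (∀ 𝒟', ¬ TopKBubblingStep w 𝒯 𝒟')

/-! Call row minus rank the level of a square. In the Rothe diagram it is the number of squares
above it in its column (`rotheRank_add_level`), so linked means equal level. A moving live square
keeps its level and a dead square inherits the level of the live square that left it. A bubbling
diagram of `w` is therefore the same as a configuration: in each column the live squares `q l` lie
at or above their initial rows `p l`, the dead squares of level `l` lie between the live squares `l`
and `l + 1` and not below `p l`, and no two columns have a dead square of the same level in the same
row. Conversely every configuration is reachable, by undoing moves (`exists_mem_BD_represents`).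

It remains to transform a configuration, without losing squares in any row, until it is full at
every distinguished square. For vexillary `w` the columns of the Rothe diagram form a chain under
inclusion, and a larger column has no gaps between a square missing from a smaller column and the
last row of the latter. The distinguished squares are treated in their greedy order. When column `j`
and level `m` are due, every unused column with a square of level `m` contains column `j`, and the
relevant levels after `m` are blocked by columns that are already full (`Vexillary.isGreedyStep`).
The dead squares of level `m` in column `j` are then increased in number by three operations:
pushing live squares down (`IsColumn.push`), exchanging the lower parts of two columns
(`IsColumn.exchange_below`), or exchanging their upper parts (`IsColumn.exchange_above`). If none
applies, the column can be filled directly (`IsConfig.fill`).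

At the end any further dead square would share its level and row with a dead square of a full
column, so the dead squares are exactly those of the top diagram (`IsConfig.dead_iff`). Both phases
of the construction of the top diagram lower the sum of the live rows, hence stop, and the positions
at which they stop are forced; this gives existence and uniqueness. -/

/-! ### Single columns, and exchanges between two columns -/

/-- A column of a configuration: `q l` is the row of the `l`-th live square, `F l` the set of rows
of the dead squares between the live squares `l` and `l + 1`, and `p l` the initial row of the
`l`-th live square. Live squares starting at or below row `n` are immobile sentinels. -/
structure IsColumn (p : ℕ → ℕ) (n : ℕ) (q : ℕ → ℕ) (F : ℕ → ℕ → Prop) : Prop where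
  lt_succ : ∀ l, q l < q (l + 1)
  le : ∀ l, q l ≤ p l
  fix : ∀ l, n ≤ p l → q l = p l
  dead : ∀ l i, F l i → q l < i ∧ i ≤ p l ∧ i < q (l + 1)

/-- A row is occupied by a live or a dead square of the column. -/
def Occupied (q : ℕ → ℕ) (F : ℕ → ℕ → Prop) (i : ℕ) : Prop := ∃ l, q l = i ∨ F l i

namespace IsColumn

variable {p q : ℕ → ℕ} {n : ℕ} {F : ℕ → ℕ → Prop}

theorem strictMono (h : IsColumn p n q F) : StrictMono q := strictMono_nat_of_lt_succ h.lt_succ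

theorem dead_lt (h : IsColumn p n q F) {l i : ℕ} (hF : F l i) : p l < n := by
  by_contra hn
  have h1 := h.fix l (by omega)
  have h2 := h.dead l i hF
  omega

theorem self_le (h : IsColumn p n q F) (l : ℕ) : l ≤ q l := h.strictMono.le_apply

theorem not_dead_live (h : IsColumn p n q F) {l l' : ℕ} : ¬ F l (q l') := by
  intro hF
  have h1 := h.dead _ _ hF
  have h2 := h.strictMono.lt_iff_lt.1 h1.1
  have h3 := h.strictMono.lt_iff_lt.1 h1.2.2
  omega

/-- The squares of level `l` lie in the interval from `q l` to `q (l + 1)`, and these half-open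
intervals are disjoint. -/
theorem level_unique (h : IsColumn p n q F) {l l' i : ℕ} (h1 : q l = i ∨ F l i)
    (h2 : q l' = i ∨ F l' i) : l = l' := by
  have a1 : q l ≤ i ∧ i < q (l + 1) := by
    rcases h1 with rfl | h1
    · exact ⟨le_rfl, h.lt_succ l⟩
    · have := h.dead _ _ h1; omega
  have a2 : q l' ≤ i ∧ i < q (l' + 1) := by
    rcases h2 with rfl | h2
    · exact ⟨le_rfl, h.lt_succ l'⟩
    · have := h.dead _ _ h2; omega
  have b1 := h.strictMono.lt_iff_lt.1 (lt_of_le_of_lt a1.1 a2.2)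
  have b2 := h.strictMono.lt_iff_lt.1 (lt_of_le_of_lt a2.1 a1.2)
  omega

end IsColumn

theorem add_le_of_strictMono {p : ℕ → ℕ} (hp : StrictMono p) {a b : ℕ} (h : a ≤ b) :
    p a + (b - a) ≤ p b := by
  induction b, h using Nat.le_induction with
  | base => simp
  | succ b hb ih => have := hp (Nat.lt_succ_self b); simp only [Nat.succ_eq_add_one] at this; omega

theorem exists_eq_le_eq_gt (m : ℕ) (f g : ℕ → ℕ) :
    ∃ q : ℕ → ℕ, (∀ l, l ≤ m → q l = f l) ∧ ∀ l, m < l → q l = g l :=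
  ⟨fun l => if l ≤ m then f l else g l, fun l hl => if_pos hl, fun l hl => if_neg (by omega)⟩

/-- If the live square `m + 1` lies above the initial row of the live square `m`, then the row of
the former can be turned into a dead row by moving the live squares after `m` down. -/
theorem IsColumn.push {p q : ℕ → ℕ} {n m : ℕ} {F : ℕ → ℕ → Prop} (h : IsColumn p n q F)
    (hp : StrictMono p) (hm : q (m + 1) ≤ p m) (hF : ∀ l i, m < l → ¬ F l i) :
    ∃ q', IsColumn p n q' (fun l i => F l i ∨ (l = m ∧ i = q (m + 1))) ∧
      (∀ i, Occupied q F i → Occupied q' (fun l i => F l i ∨ (l = m ∧ i = q (m + 1))) i) := by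
  have hpl : ∀ l, m < l → q (m + 1) + (l - m) ≤ p l := fun l hl => by
    have := add_le_of_strictMono hp hl.le
    omega
  -- The least displacement that frees row `q (m + 1)`: a live square moves down only if the one
  -- above it forces it to. The bound by `p l` holds since `q (m + 1) ≤ p m` and `p` is strictly
  -- increasing.
  obtain ⟨q', a, b⟩ := exists_eq_le_eq_gt m q fun l => max (q l) (q (m + 1) + (l - m))
  refine ⟨q', ⟨fun l => ?_, fun l => ?_, fun l hl => ?_, fun l i hi => ?_⟩, fun i hi => ?_⟩
  · have := h.lt_succ l
    have := a l
    have := b l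
    have := a (l + 1)
    have := b (l + 1)
    rcases lt_trichotomy l m with c | rfl | c <;> omega
  · have := h.le l
    have := a l
    have := b l
    have := hpl l
    omega
  · have := h.fix l hl
    have := a l
    have := b l
    have := hpl l
    omega
  · rcases hi with hi | ⟨rfl, rfl⟩
    · have h0 : l ≤ m := by
        by_contra hc
        exact hF l i (by omega) hi
      have := h.dead _ _ hi
      have := a l
      have := a (l + 1)
      have := b (l + 1)
      omega
    · have := h.lt_succ l
      have := a l
      have := b (l + 1)
      omega
  · obtain ⟨l, rfl | hl⟩ := hi
    · by_cases h1 : l ≤ m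
      · exact ⟨l, Or.inl (a l h1)⟩
      have := b l
      by_cases h2 : q (m + 1) + (l - m) ≤ q l
      · exact ⟨l, Or.inl (by omega)⟩
      by_cases h3 : l = m + 1
      · subst h3
        exact ⟨m, Or.inr (Or.inr ⟨rfl, rfl⟩)⟩
      -- A displaced square had no gap between itself and live square `m + 1`, so its old row is
      -- taken over by its predecessor.
      · refine ⟨l - 1, Or.inl ?_⟩
        have h4 := add_le_of_strictMono h.strictMono (show m + 1 ≤ l by omega)
        have h5 := h.strictMono (show l - 1 < l by omega)
        have := b (l - 1)
        omega
    · exact ⟨l, Or.inr (Or.inl hl)⟩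

/-- Exchange of the lower parts of two columns. -/
theorem IsColumn.exchange_below {p₁ p₂ q₁ q₂ : ℕ → ℕ} {n m : ℕ} {F₁ F₂ : ℕ → ℕ → Prop}
    (h₁ : IsColumn p₁ n q₁ F₁) (h₂ : IsColumn p₂ n q₂ F₂) (hp : ∀ l, p₂ l ≤ p₁ l)
    (hd₁ : ∀ l i, m < l → ¬ F₁ l i) (hd₂ : ∀ l i, m < l → p₁ l < n → ¬ F₂ l i)
    (hi : F₂ m (q₁ (m + 1))) :
    ∃ q₁' q₂' F₁' F₂', IsColumn p₁ n q₁' F₁' ∧ IsColumn p₂ n q₂' F₂' ∧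
      (∀ l i, F₁' l i → F₁ l i ∨ F₂ l i) ∧ (∀ l i, F₂' l i → F₂ l i) ∧
      (∀ l i, F₁' l i → F₂' l i → F₁ l i ∧ F₂ l i) ∧
      (∀ i, F₁ m i → F₁' m i) ∧ F₁' m (q₁ (m + 1)) ∧
      (∀ i < n, Occupied q₁ F₁ i → Occupied q₂ F₂ i → Occupied q₁' F₁' i ∧ Occupied q₂' F₂' i) ∧
      (∀ i < n, Occupied q₁ F₁ i ∨ Occupied q₂ F₂ i →
        Occupied q₁' F₁' i ∨ Occupied q₂' F₂' i) := by
  have hi' := h₂.dead _ _ hi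
  have s₁ := h₁.strictMono
  have s₂ := h₂.strictMono
  -- At levels where the first column has only sentinels, maximum and minimum leave both columns
  -- unchanged; so dead squares of the second column are harmless there.
  have hfix : ∀ l, n ≤ p₁ l → q₂ l ≤ q₁ l := fun l hl => by
    rw [h₁.fix l hl]; exact (h₂.le l).trans (hp l)
  -- A plain swap of the tails could violate the bound `p₂`. Giving the lower of the two live
  -- squares to the first column respects both bounds because `p₂ ≤ p₁`. The dead squares of level
  -- `m` in rows from `q₁ (m + 1)` on pass to the first column.
  obtain ⟨r₁, a₁, b₁⟩ := exists_eq_le_eq_gt m q₁ fun l => max (q₁ l) (q₂ l)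
  obtain ⟨r₂, a₂, b₂⟩ := exists_eq_le_eq_gt m q₂ fun l => min (q₁ l) (q₂ l)
  refine ⟨r₁, r₂, fun l i => F₁ l i ∨ (l = m ∧ F₂ m i ∧ q₁ (m + 1) ≤ i),
    fun l i => F₂ l i ∧ ¬ (l = m ∧ q₁ (m + 1) ≤ i), ⟨fun l => ?_, fun l => ?_, fun l hl => ?_,
    fun l i hF => ?_⟩, ⟨fun l => ?_, fun l => ?_, fun l hl => ?_, fun l i hF => ?_⟩,
    ?_, ?_, ?_, ?_, ?_, ?_, ?_⟩
  · have := h₁.lt_succ l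
    have := h₂.lt_succ l
    have := a₁ l
    have := b₁ l
    have := a₁ (l + 1)
    have := b₁ (l + 1)
    omega
  · have := h₁.le l
    have := h₂.le l
    have := hp l
    have := a₁ l
    have := b₁ l
    omega
  · have := h₁.fix l hl
    have := hfix l hl
    have := a₁ l
    have := b₁ l
    omega
  · have := a₁ l
    have := a₁ (l + 1)
    have := b₁ (l + 1)
    rcases hF with hF | ⟨rfl, hF, hle⟩
    · have h0 : l ≤ m := by
        by_contra hc
        exact hd₁ l i (by omega) hF
      have := h₁.dead _ _ hF
      omega
    · have := h₂.dead _ _ hF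
      have := h₁.lt_succ l
      have := hp l
      omega
  · have := h₁.lt_succ l
    have := h₂.lt_succ l
    have := a₂ l
    have := b₂ l
    have := a₂ (l + 1)
    have := b₂ (l + 1)
    rcases lt_trichotomy l m with c | rfl | c <;> omega
  · have := h₂.le l
    have := a₂ l
    have := b₂ l
    omega
  · have := h₂.fix l hl
    have := hfix l (hl.trans (hp l))
    have := a₂ l
    have := b₂ l
    omega
  · obtain ⟨hF, hne⟩ := hF
    have := h₂.dead _ _ hF
    have := a₂ l
    have := b₂ l
    have := a₂ (l + 1)
    have := b₂ (l + 1)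
    rcases lt_trichotomy l m with c | c | c
    · omega
    · subst c
      simp only [true_and, not_le] at hne
      omega
    · have h3 : n ≤ p₁ l := by
        by_contra hc
        exact hd₂ l i c (by omega) hF
      have h4 : n ≤ p₁ (l + 1) := by
        have := h₁.fix l h3
        have := h₁.lt_succ l
        have := h₁.le (l + 1)
        omega
      have := hfix _ h3
      have := hfix _ h4
      omega
  · rintro l i (hF | ⟨rfl, hF, -⟩)
    · exact Or.inl hF
    · exact Or.inr hF
  · exact fun l i hF => hF.1
  · rintro l i (hF | ⟨rfl, hF, hle⟩) hF2
    · exact ⟨hF, hF2.1⟩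
    · exact absurd ⟨rfl, hle⟩ hF2.2
  · exact fun i hF => Or.inl hF
  · exact Or.inr ⟨rfl, hi, le_rfl⟩
  · rintro i hin ⟨l, hl⟩ ⟨k, hk⟩
    by_cases hlow : i < q₁ (m + 1)
    · constructor
      · have hlm : l ≤ m := by
          by_contra hc
          have h3 := s₁.monotone (show m + 1 ≤ l by omega)
          rcases hl with hl | hl
          · omega
          · have := h₁.dead _ _ hl; omega
        refine ⟨l, ?_⟩
        rcases hl with hl | hl
        · left; rw [a₁ l hlm]; exact hl
        · right; left; exact hl
      · have hkm : k ≤ m := by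
          by_contra hc
          have h3 := s₂.monotone (show m + 1 ≤ k by omega)
          rcases hk with hk | hk
          · omega
          · have := h₂.dead _ _ hk; omega
        refine ⟨k, ?_⟩
        rcases hk with hk | hk
        · left; rw [a₂ k hkm]; exact hk
        · right; exact ⟨hk, by omega⟩
    · push Not at hlow
      have hlm : m < l := by
        by_contra hc
        have h3 := s₁.monotone (show l + 1 ≤ m + 1 by omega)
        have := h₁.lt_succ l
        rcases hl with hl | hl
        · omega
        · have := h₁.dead _ _ hl; omega
      have hl' : q₁ l = i := by
        rcases hl with hl | hl
        · exact hl
        · exact absurd hl (hd₁ _ _ hlm)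
      have e1 := b₁ l hlm
      have e2 := b₂ l hlm
      rcases hk with hk | hk
      · have hkm : m < k := by
          by_contra hc
          have h3 := s₂.monotone (show k ≤ m by omega)
          omega
        have e3 := b₁ k hkm
        have e4 := b₂ k hkm
        rcases lt_trichotomy l k with c | c | c
        · have := s₁ c
          have := s₂ c
          exact ⟨⟨l, Or.inl (by omega)⟩, ⟨k, Or.inl (by omega)⟩⟩
        · subst c
          exact ⟨⟨l, Or.inl (by omega)⟩, ⟨l, Or.inl (by omega)⟩⟩
        · have := s₁ c
          have := s₂ c
          exact ⟨⟨k, Or.inl (by omega)⟩, ⟨l, Or.inl (by omega)⟩⟩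
      · have hk' := h₂.dead _ _ hk
        rcases lt_trichotomy k m with c | c | c
        · have h3 := s₂.monotone (show k + 1 ≤ m by omega)
          omega
        · subst c
          have h3 := s₂.monotone (show k + 1 ≤ l by omega)
          exact ⟨⟨k, Or.inr (Or.inr ⟨rfl, hk, hlow⟩)⟩, ⟨l, Or.inl (by omega)⟩⟩
        · have h3 : n ≤ p₁ k := by
            by_contra hc
            exact hd₂ k i c (by omega) hk
          have h4 := h₁.fix k h3
          have h5 : l < k := s₁.lt_iff_lt.1 (by omega)
          have h6 := s₂ h5
          exact ⟨⟨l, Or.inl (by omega)⟩, ⟨k, Or.inr ⟨hk, by omega⟩⟩⟩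
  · rintro i hin (⟨l, hl | hl⟩ | ⟨l, hl | hl⟩)
    · have := a₁ l
      have := b₁ l
      have := b₂ l
      by_cases c : l ≤ m ∨ q₂ l ≤ q₁ l
      · exact Or.inl ⟨l, Or.inl (by omega)⟩
      · exact Or.inr ⟨l, Or.inl (by omega)⟩
    · exact Or.inl ⟨l, Or.inr (Or.inl hl)⟩
    · have := a₂ l
      have := b₁ l
      have := b₂ l
      by_cases c : l ≤ m ∨ q₂ l ≤ q₁ l
      · exact Or.inr ⟨l, Or.inl (by omega)⟩
      · exact Or.inl ⟨l, Or.inl (by omega)⟩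
    · by_cases c : l = m ∧ q₁ (m + 1) ≤ i
      · obtain ⟨rfl, c⟩ := c
        exact Or.inl ⟨l, Or.inr (Or.inr ⟨rfl, hl, c⟩)⟩
      · exact Or.inr ⟨l, Or.inr ⟨hl, c⟩⟩

theorem eq_add_of_forall_succ {p : ℕ → ℕ} {l m : ℕ} (h : ∀ k, l ≤ k → k ≤ m → p (k + 1) = p k + 1)
    (hl : l ≤ m + 1) : p (m + 1) = p l + (m + 1 - l) := by
  induction m with
  | zero =>
    obtain rfl | rfl : l = 0 ∨ l = 1 := by omega
    · simpa using h 0 le_rfl le_rfl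
    · simp
  | succ m ih =>
    rcases Nat.lt_or_ge l (m + 2) with c | c
    · have h1 := ih (fun k h1 h2 => h k h1 (by omega)) (by omega)
      have h2 := h (m + 1) (by omega) le_rfl
      omega
    · have : l = m + 2 := by omega
      subst this
      simp

/-- Exchange of the upper parts of two columns: all dead squares of level `m` are moved to the first
column, which is then filled down to the row `p₁ m`. -/
theorem IsColumn.exchange_above {p₁ p₂ q₁ q₂ : ℕ → ℕ} {n m e : ℕ} {F₁ F₂ : ℕ → ℕ → Prop}
    (h₁ : IsColumn p₁ n q₁ F₁) (h₂ : IsColumn p₂ n q₂ F₂) (s : StrictMono p₁)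
    (hp : ∀ l, l ≤ m → p₂ l ≤ p₁ l)
    (hp' : ∀ l, l ≤ m → p₂ l = p₁ l ∨ ∀ k, l ≤ k → k ≤ m → p₂ (k + 1) = p₂ k + 1)
    (hn : p₁ m < n) (hq : p₁ m < q₁ (m + 1)) (he : e = min (q₂ (m + 1)) (p₁ m + 1))
    (hdis : ∀ l i, F₁ l i → ¬ F₂ l i) (hd₁ : ∀ l i, m < l → ¬ F₁ l i) :
    ∃ q₁' q₂' F₁' F₂', IsColumn p₁ n q₁' F₁' ∧ IsColumn p₂ n q₂' F₂' ∧
      (∀ l i, F₁' l i → F₁ l i ∨ F₂ l i ∨ (l = m ∧ e ≤ i)) ∧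
      (∀ l i, F₂' l i → F₁ l i ∨ F₂ l i) ∧
      (∀ l i, F₁' l i → ¬ F₂' l i) ∧
      (∀ i, F₁ m i ∨ F₂ m i → F₁' m i) ∧
      (∀ i, Occupied q₁ F₁ i → Occupied q₂ F₂ i → Occupied q₁' F₁' i ∧ Occupied q₂' F₂' i) ∧
      (∀ i, Occupied q₁ F₁ i ∨ Occupied q₂ F₂ i →
        Occupied q₁' F₁' i ∨ Occupied q₂' F₂' i) := by
  have s₁ := h₁.strictMono
  have s₂ := h₂.strictMono
  have hqm : q₂ m < e := by
    have := h₂.lt_succ m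
    have := h₂.le m
    have := hp m le_rfl
    omega
  -- The rows `E + l` with `l ≤ m` are consecutive and end at `e - 1`. They cap the live squares of
  -- the second column, so that level `m` stays above row `e`.
  obtain ⟨E, hE⟩ : ∃ E, e = E + (m + 1) := ⟨e - (m + 1), by have := h₂.self_le m; omega⟩
  have hqE : ∀ l, l ≤ m → q₂ l ≤ E + l := fun l hl => by
    have := add_le_of_strictMono s₂ hl
    omega
  obtain ⟨r₁, a₁, b₁⟩ := exists_eq_le_eq_gt m (fun l => min (q₁ l) (q₂ l)) q₁
  obtain ⟨r₂, a₂, b₂⟩ :=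
    exists_eq_le_eq_gt m (fun l => min (max (q₁ l) (q₂ l)) (E + l)) q₂
  -- If the initial rows differ at level `l`, the second column is initially gapless from `l` to `m
  -- + 1`; then `e ≤ q₂ (m + 1) ≤ p₂ (m + 1)` gives `E + l ≤ p₂ l`. If they agree, the maximum is
  -- already within bounds.
  have hle₂ : ∀ l, r₂ l ≤ p₂ l := fun l => by
    have h3 := h₂.le l
    have h4 := b₂ l
    have h5 := a₂ l
    rcases Nat.lt_or_ge m l with c | c
    · omega
    · rcases hp' l c with d | d
      · have := h₁.le l
        omega
      · have := eq_add_of_forall_succ d (by omega)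
        have := h₂.le (m + 1)
        omega
  -- Below level `m`, each old dead square goes to the second column if it fits there, and otherwise
  -- to the first if it fits there; this keeps the two dead sets disjoint. Level `m` belongs to the
  -- first column alone.
  obtain ⟨G₂, hG₂⟩ : ∃ G₂ : ℕ → ℕ → Prop, ∀ l i, G₂ l i ↔
      (l < m ∧ (F₁ l i ∨ F₂ l i) ∧ r₂ l < i ∧ i < r₂ (l + 1)) ∨ (m < l ∧ F₂ l i) :=
    ⟨_, fun _ _ => Iff.rfl⟩
  obtain ⟨G₁, hG₁⟩ : ∃ G₁ : ℕ → ℕ → Prop, ∀ l i, G₁ l i ↔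
      (l < m ∧ (F₁ l i ∨ F₂ l i) ∧ r₁ l < i ∧ i < r₁ (l + 1) ∧ ¬ G₂ l i) ∨
      (l = m ∧ (F₁ m i ∨ F₂ m i ∨ (e ≤ i ∧ i ≤ p₁ m))) :=
    ⟨_, fun _ _ => Iff.rfl⟩
  have C₁ : IsColumn p₁ n r₁ G₁ := by
    refine ⟨fun l => ?_, fun l => ?_, fun l hl => ?_, fun l i hF => ?_⟩
    · have := h₁.lt_succ l
      have := h₂.lt_succ l
      have := a₁ l
      have := b₁ l
      have := a₁ (l + 1)
      have := b₁ (l + 1)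
      rcases lt_trichotomy l m with c | rfl | c <;> omega
    · have := h₁.le l
      have := a₁ l
      have := b₁ l
      omega
    · have h3 : m < l := s.lt_iff_lt.1 (by omega)
      rw [b₁ l h3]
      exact h₁.fix l hl
    · rcases (hG₁ l i).1 hF with ⟨hl, h3, h4, h5, -⟩ | ⟨rfl, h3⟩
      · refine ⟨h4, ?_, h5⟩
        rcases h3 with h3 | h3
        · exact (h₁.dead _ _ h3).2.1
        · exact (h₂.dead _ _ h3).2.1.trans (hp l hl.le)
      · have := a₁ l
        have := b₁ (l + 1)
        have := hp l le_rfl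
        rcases h3 with h3 | h3 | h3
        · have := h₁.dead _ _ h3
          omega
        · have := h₂.dead _ _ h3
          omega
        · omega
  have C₂ : IsColumn p₂ n r₂ G₂ := by
    refine ⟨fun l => ?_, hle₂, fun l hl => ?_, fun l i hF => ?_⟩
    · have := h₁.lt_succ l
      have := h₂.lt_succ l
      have := a₂ l
      have := b₂ l
      have := a₂ (l + 1)
      have := b₂ (l + 1)
      rcases lt_trichotomy l m with c | rfl | c <;> omega
    · have h3 : m < l := by
        by_contra hc
        have := hp l (by omega)
        have := s.monotone (show l ≤ m by omega)
        omega
      rw [b₂ l h3]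
      exact h₂.fix l hl
    · rcases (hG₂ l i).1 hF with ⟨hl, h3, h4, h5⟩ | ⟨hl, h3⟩
      · refine ⟨h4, ?_, h5⟩
        rcases h3 with h3 | h3
        · have h6 := (h₁.dead _ _ h3).2.1
          rcases hp' l hl.le with d | d
          · omega
          · have := d l le_rfl hl.le
            have := hle₂ (l + 1)
            omega
        · exact (h₂.dead _ _ h3).2.1
      · rw [b₂ l hl, b₂ (l + 1) (by omega)]
        exact h₂.dead _ _ h3
  -- Once the cap takes effect at some level it does so at all later ones up to `m`, and these live
  -- squares occupy every row down to `e - 1`. Nothing is lost by the truncation.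
  have tail : ∀ l i, l ≤ m → E + l ≤ max (q₁ l) (q₂ l) → E + l ≤ i → i < e →
      Occupied r₂ G₂ i := fun l i hl h3 h4 h5 => by
    refine ⟨i - E, Or.inl ?_⟩
    have := a₂ (i - E) (by omega)
    have := add_le_of_strictMono s₁ (show l ≤ i - E by omega)
    have := add_le_of_strictMono s₂ (show l ≤ i - E by omega)
    omega
  have liveMax : ∀ l i, l ≤ m → i < e → max (q₁ l) (q₂ l) = i → Occupied r₂ G₂ i :=
    fun l i hl h3 h4 => by
      by_cases c : E + l ≤ i
      · exact tail l i hl (by omega) c h3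
      · have := a₂ l hl
        exact ⟨l, Or.inl (by omega)⟩
  have liveMin : ∀ l i, l ≤ m → min (q₁ l) (q₂ l) = i → Occupied r₁ G₁ i :=
    fun l i hl h3 => by
      have := a₁ l hl
      exact ⟨l, Or.inl (by omega)⟩
  have deadMax : ∀ l i, l < m → i < e → (F₁ l i ∨ F₂ l i) → max (q₁ l) (q₂ l) < i →
      i < max (q₁ (l + 1)) (q₂ (l + 1)) → Occupied r₂ G₂ i := fun l i hl h3 h4 h5 h6 => by
    by_cases c : E + (l + 1) ≤ i
    · exact tail (l + 1) i hl (by omega) c h3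
    · have := a₂ l hl.le
      have := a₂ (l + 1) hl
      exact ⟨l, Or.inr ((hG₂ l i).2 (Or.inl ⟨hl, h4, by omega, by omega⟩))⟩
  have deadMin : ∀ l i, l ≤ m → (F₁ l i ∨ F₂ l i) → min (q₁ l) (q₂ l) < i →
      i < min (q₁ (l + 1)) (q₂ (l + 1)) → i < max (q₁ l) (q₂ l) → Occupied r₁ G₁ i :=
    fun l i hl h4 h5 h6 h7 => by
      rcases hl.eq_or_lt with rfl | hl
      · exact ⟨l, Or.inr ((hG₁ l i).2 (Or.inr ⟨rfl, by tauto⟩))⟩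
      have := a₁ l hl.le
      have := a₁ (l + 1) hl
      refine ⟨l, Or.inr ((hG₁ l i).2 (Or.inl ⟨hl, h4, by omega, by omega, fun hG => ?_⟩))⟩
      have h8 := C₂.dead _ _ hG
      have := a₂ l hl.le
      have := a₂ (l + 1) hl
      omega
  have lev₁ : ∀ l i, (q₁ l = i ∨ F₁ l i) → q₁ l ≤ i ∧ i < q₁ (l + 1) ∧ i ≤ p₁ l := by
    rintro l i (rfl | hF)
    · exact ⟨le_rfl, h₁.lt_succ l, h₁.le l⟩
    · have := h₁.dead _ _ hF
      omega
  have lev₂ : ∀ l i, (q₂ l = i ∨ F₂ l i) → q₂ l ≤ i ∧ i < q₂ (l + 1) ∧ i ≤ p₂ l := by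
    rintro l i (rfl | hF)
    · exact ⟨le_rfl, h₂.lt_succ l, h₂.le l⟩
    · have := h₂.dead _ _ hF
      omega
  have keep₁ : ∀ i, e ≤ i → Occupied q₁ F₁ i → Occupied r₁ G₁ i := by
    rintro i hi ⟨l, hl⟩
    by_cases c : i ≤ p₁ m
    · exact ⟨m, Or.inr ((hG₁ m i).2 (Or.inr ⟨rfl, by tauto⟩))⟩
    have h3 := lev₁ l i hl
    have h4 : m < l := s.lt_iff_lt.1 (by omega)
    rcases hl with hl | hl
    · exact ⟨l, Or.inl (by rw [b₁ l h4, hl])⟩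
    · exact absurd hl (hd₁ l i h4)
  have keep₂ : ∀ i, e ≤ i → Occupied q₂ F₂ i → Occupied r₂ G₂ i := by
    rintro i hi ⟨l, hl⟩
    have h3 := lev₂ l i hl
    have h4 : m < l := by
      by_contra hc
      have := s₂.monotone (show l + 1 ≤ m + 1 by omega)
      have := s.monotone (show l ≤ m by omega)
      have := hp l (by omega)
      omega
    rcases hl with hl | hl
    · exact ⟨l, Or.inl (by rw [b₂ l h4, hl])⟩
    · exact ⟨l, Or.inr ((hG₂ l i).2 (Or.inr ⟨h4, hl⟩))⟩
  have low₁ : ∀ l i, i < e → (q₁ l = i ∨ F₁ l i) → l ≤ m := fun l i hi hl => by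
    have := lev₁ l i hl
    have : l < m + 1 := s₁.lt_iff_lt.1 (by omega)
    omega
  have low₂ : ∀ l i, i < e → (q₂ l = i ∨ F₂ l i) → l ≤ m := fun l i hi hl => by
    have := lev₂ l i hl
    have : l < m + 1 := s₂.lt_iff_lt.1 (by omega)
    omega
  refine ⟨r₁, r₂, G₁, G₂, C₁, C₂, fun l i hG => ?_, fun l i hG => ?_, fun l i hG hG' => ?_,
    fun i hF => ?_, ?_, ?_⟩
  · rcases (hG₁ l i).1 hG with ⟨hl, h3, -⟩ | ⟨rfl, h3⟩ <;> tauto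
  · rcases (hG₂ l i).1 hG with ⟨hl, h3, -⟩ | ⟨hl, h3⟩ <;> tauto
  · rcases (hG₁ l i).1 hG with ⟨hl, h3, h4, h5, h6⟩ | ⟨rfl, h3⟩
    · exact h6 hG'
    · rcases (hG₂ l i).1 hG' with ⟨hl, -⟩ | ⟨hl, -⟩ <;> omega
  · exact (hG₁ m i).2 (Or.inr ⟨rfl, by tauto⟩)
  · rintro i ⟨l, hl⟩ ⟨k, hk⟩
    by_cases hi : e ≤ i
    · exact ⟨keep₁ i hi ⟨l, hl⟩, keep₂ i hi ⟨k, hk⟩⟩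
    push Not at hi
    have hlm := low₁ l i hi hl
    have hkm := low₂ k i hi hk
    have hl' := lev₁ l i hl
    have hk' := lev₂ k i hk
    rcases lt_trichotomy l k with c | c | c
    · have e1 := s₁.monotone (show l + 1 ≤ k by omega)
      have e2 := s₂.monotone (show l + 1 ≤ k by omega)
      have e3 := h₁.lt_succ k
      have e4 := h₂.lt_succ l
      constructor
      · rcases hk with hk | hk
        · exact liveMin k i hkm (by omega)
        · have := h₂.dead _ _ hk
          exact deadMin k i hkm (Or.inr hk) (by omega) (by omega) (by omega)
      · rcases hl with hl | hl
        · exact liveMax l i hlm hi (by omega)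
        · have := h₁.dead _ _ hl
          exact deadMax l i (by omega) hi (Or.inl hl) (by omega) (by omega)
    · subst c
      rcases hl with hl | hl
      · refine ⟨?_, liveMax l i hlm hi (by omega)⟩
        rcases hk with hk | hk
        · exact liveMin l i hlm (by omega)
        · rcases hlm.eq_or_lt with rfl | hlm
          · exact ⟨l, Or.inr ((hG₁ l i).2 (Or.inr ⟨rfl, by tauto⟩))⟩
          · have := h₂.dead _ _ hk
            have := a₁ l hlm.le
            have := a₁ (l + 1) hlm
            refine ⟨l, Or.inr ((hG₁ l i).2 (Or.inl ⟨hlm, Or.inr hk, by omega, by omega, ?_⟩))⟩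
            intro hG
            have h8 := C₂.dead _ _ hG
            have := a₂ l hlm.le
            have := a₂ (l + 1) hlm
            omega
      · rcases hk with hk | hk
        · refine ⟨?_, liveMax l i hlm hi (by omega)⟩
          rcases hlm.eq_or_lt with rfl | hlm
          · exact ⟨l, Or.inr ((hG₁ l i).2 (Or.inr ⟨rfl, by tauto⟩))⟩
          · have := h₁.dead _ _ hl
            have := a₁ l hlm.le
            have := a₁ (l + 1) hlm
            refine ⟨l, Or.inr ((hG₁ l i).2 (Or.inl ⟨hlm, Or.inl hl, by omega, by omega, ?_⟩))⟩
            intro hG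
            have h8 := C₂.dead _ _ hG
            have := a₂ l hlm.le
            have := a₂ (l + 1) hlm
            omega
        · exact absurd hk (hdis _ _ hl)
    · have e1 := s₁.monotone (show k + 1 ≤ l by omega)
      have e2 := s₂.monotone (show k + 1 ≤ l by omega)
      have e3 := h₁.lt_succ k
      have e4 := h₂.lt_succ l
      constructor
      · rcases hl with hl | hl
        · exact liveMin l i hlm (by omega)
        · have := h₁.dead _ _ hl
          exact deadMin l i hlm (Or.inl hl) (by omega) (by omega) (by omega)
      · rcases hk with hk | hk
        · exact liveMax k i hkm hi (by omega)
        · have := h₂.dead _ _ hk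
          exact deadMax k i (by omega) hi (Or.inr hk) (by omega) (by omega)
  · intro i hocc
    by_cases hi : e ≤ i
    · exact hocc.imp (keep₁ i hi) (keep₂ i hi)
    push Not at hi
    have live : ∀ l, l ≤ m → q₁ l = i ∨ q₂ l = i → Occupied r₁ G₁ i ∨ Occupied r₂ G₂ i := by
      intro l hl h3
      by_cases c : min (q₁ l) (q₂ l) = i
      · exact Or.inl (liveMin l i hl c)
      · exact Or.inr (liveMax l i hl hi (by omega))
    have dead : ∀ l, l ≤ m → F₁ l i ∨ F₂ l i → min (q₁ l) (q₂ l) < i →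
        i < max (q₁ (l + 1)) (q₂ (l + 1)) → Occupied r₁ G₁ i ∨ Occupied r₂ G₂ i := by
      intro l hl h3 h4 h5
      by_cases c : l = m
      · subst c
        exact Or.inl ⟨l, Or.inr ((hG₁ l i).2 (Or.inr ⟨rfl, by tauto⟩))⟩
      by_cases c1 : max (q₁ l) (q₂ l) < i
      · exact Or.inr (deadMax l i (by omega) hi h3 c1 h5)
      · by_cases c2 : max (q₁ l) (q₂ l) = i
        · exact Or.inr (liveMax l i hl hi c2)
        · have := h₁.lt_succ l
          have := h₂.lt_succ l
          rcases h3 with h3 | h3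
          · have := h₁.dead _ _ h3
            exact Or.inl (deadMin l i hl (Or.inl h3) h4 (by omega) (by omega))
          · have := h₂.dead _ _ h3
            exact Or.inl (deadMin l i hl (Or.inr h3) h4 (by omega) (by omega))
    rcases hocc with ⟨l, hl⟩ | ⟨l, hl⟩
    · have hlm := low₁ l i hi hl
      rcases hl with hl | hl
      · exact live l hlm (Or.inl hl)
      · have := h₁.dead _ _ hl
        exact dead l hlm (Or.inl hl) (by omega) (by omega)
    · have hlm := low₂ l i hi hl
      rcases hl with hl | hl
      · exact live l hlm (Or.inr hl)
      · have := h₂.dead _ _ hl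
        exact dead l hlm (Or.inr hl) (by omega) (by omega)

/-! ### Configurations and the filling of greedily chosen columns -/

/-- A configuration: a family of columns in which no two columns have dead squares of the same
level in the same row. -/
structure IsConfig {ι : Type*} (p : ι → ℕ → ℕ) (n : ℕ) (q : ι → ℕ → ℕ)
    (F : ι → ℕ → ℕ → Prop) : Prop where
  column : ∀ j, IsColumn (p j) n (q j) (F j)
  uniq : ∀ j k l i, F j l i → F k l i → j = k

open Classical in
/-- The number of occupied squares in row `i`. -/
noncomputable def occupiedCount {ι : Type*} [Fintype ι] (q : ι → ℕ → ℕ) (F : ι → ℕ → ℕ → Prop)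
    (i : ℕ) : ℕ :=
  (Finset.univ.filter fun j => Occupied (q j) (F j) i).card

/-- All squares of column `j` down to the initial row of the live square `m` are occupied; the
dead squares among them have level `m`. -/
structure IsFull {ι : Type*} (p : ι → ℕ → ℕ) (q : ι → ℕ → ℕ) (F : ι → ℕ → ℕ → Prop)
    (j : ι) (m : ℕ) : Prop where
  live : ∀ l, l ≤ m → q j l = l
  not_dead : ∀ l i, l < m → ¬ F j l i
  dead_iff : ∀ i, F j m i ↔ m < i ∧ i ≤ p j m

/-- `(j, m)` is a greedy choice after the choices in `B`. -/
structure IsGreedyStep {ι : Type*} (p : ι → ℕ → ℕ) (n : ℕ) (B : List (ι × ℕ)) (j : ι)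
    (m : ℕ) : Prop where
  lt : p j m < n
  notMem : ∀ b ∈ B, b.1 ≠ j
  le : ∀ k, k ≠ j → (∀ b ∈ B, b.1 ≠ k) → p k m < n → ∀ l, p k l ≤ p j l
  eq_or : ∀ k, k ≠ j → (∀ b ∈ B, b.1 ≠ k) → p k m < n → ∀ l, l ≤ m →
    p k l = p j l ∨ ∀ k', l ≤ k' → k' ≤ m → p k (k' + 1) = p k k' + 1
  blocked : ∀ l, m < l → p j l < n → ∀ k, (∀ b ∈ B, b.1 ≠ k) → p k l < n →
    ∃ b ∈ B, b.2 = l ∧ p k l ≤ p b.1 l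
  lt_of_mem : ∀ b ∈ B, m < b.2 ∨ n ≤ p b.1 m

section

variable {ι : Type*} {p : ι → ℕ → ℕ} {n : ℕ} {q : ι → ℕ → ℕ} {F : ι → ℕ → ℕ → Prop}

/-- The blocking column is full at level `l` and starts there at least as low as column `k`, so its
dead squares already use every row where column `k` could have a dead square of level `l`. -/
theorem IsConfig.not_dead_of_blocked (h : IsConfig p n q F) {B : List (ι × ℕ)} {j : ι} {m : ℕ}
    (hB : ∀ b ∈ B, IsFull p q F b.1 b.2) (hg : IsGreedyStep p n B j m) {l : ℕ} (hl : m < l)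
    (hpl : p j l < n) {k : ι} (hk : ∀ b ∈ B, b.1 ≠ k) (i : ℕ) : ¬ F k l i := by
  intro hF
  obtain ⟨b, hb, rfl, hle⟩ := hg.blocked l hl hpl k hk ((h.column k).dead_lt hF)
  have h1 := (h.column k).dead _ _ hF
  have h2 := (h.column k).self_le b.2
  exact hk b hb (h.uniq _ _ b.2 i (((hB b hb).dead_iff i).2 ⟨by omega, by omega⟩) hF)

/-- A column treated earlier is full at a level after `m`, and then has no dead squares of level
`m`, or its live square `m` is a sentinel. -/
theorem IsConfig.ne_of_dead (h : IsConfig p n q F) {B : List (ι × ℕ)} {j : ι} {m : ℕ}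
    (hB : ∀ b ∈ B, IsFull p q F b.1 b.2) (hg : IsGreedyStep p n B j m) {k : ι} {i : ℕ}
    (hF : F k m i) : ∀ b ∈ B, b.1 ≠ k := by
  rintro b hb rfl
  rcases hg.lt_of_mem b hb with h1 | h1
  · exact (hB b hb).not_dead _ _ h1 hF
  · have := (h.column b.1).dead_lt hF
    omega

variable [DecidableEq ι]

theorem IsConfig.update_one (h : IsConfig p n q F) {j : ι} {q₁ : ℕ → ℕ} {F₁ : ℕ → ℕ → Prop}
    (c₁ : IsColumn (p j) n q₁ F₁) (h₁ : ∀ l i, F₁ l i → ∀ x, x ≠ j → ¬ F x l i) :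
    IsConfig p n (Function.update q j q₁) (Function.update F j F₁) := by
  refine ⟨fun x => ?_, fun x y l i hx hy => ?_⟩
  · by_cases hx : x = j
    · subst hx; simpa using c₁
    · simpa [hx] using h.column x
  · by_cases hxj : x = j <;> by_cases hyj : y = j
    · rw [hxj, hyj]
    · subst hxj
      simp only [Function.update_self, Function.update_of_ne hyj] at hx hy
      exact absurd hy (h₁ l i hx y hyj)
    · subst hyj
      simp only [Function.update_self, Function.update_of_ne hxj] at hx hy
      exact absurd hx (h₁ l i hy x hxj)
    · simp only [Function.update_of_ne hxj, Function.update_of_ne hyj] at hx hy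
      exact h.uniq x y l i hx hy

theorem IsConfig.update_two (h : IsConfig p n q F) {j k : ι} (hjk : k ≠ j) {q₁ q₂ : ℕ → ℕ}
    {F₁ F₂ : ℕ → ℕ → Prop}
    (c₁ : IsColumn (p j) n q₁ F₁) (c₂ : IsColumn (p k) n q₂ F₂)
    (h₁₂ : ∀ l i, F₁ l i → ¬ F₂ l i)
    (h₁ : ∀ l i, F₁ l i → ∀ x, x ≠ j → x ≠ k → ¬ F x l i)
    (h₂ : ∀ l i, F₂ l i → ∀ x, x ≠ j → x ≠ k → ¬ F x l i) :
    IsConfig p n (Function.update (Function.update q j q₁) k q₂)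
      (Function.update (Function.update F j F₁) k F₂) := by
  refine ⟨fun x => ?_, fun x y l i hx hy => ?_⟩
  · by_cases hx : x = k
    · subst hx; simpa using c₂
    by_cases hx' : x = j
    · subst hx'; simpa [hx] using c₁
    · simpa [hx, hx'] using h.column x
  · have key : ∀ z, Function.update (Function.update F j F₁) k F₂ z l i →
        (z = k ∧ F₂ l i) ∨ (z = j ∧ F₁ l i) ∨ (z ≠ j ∧ z ≠ k ∧ F z l i) := fun z hz => by
      by_cases c : z = k
      · subst c
        simp only [Function.update_self] at hz
        exact Or.inl ⟨rfl, hz⟩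
      by_cases c' : z = j
      · subst c'
        simp only [Function.update_of_ne c, Function.update_self] at hz
        exact Or.inr (Or.inl ⟨rfl, hz⟩)
      · simp only [Function.update_of_ne c, Function.update_of_ne c'] at hz
        exact Or.inr (Or.inr ⟨c', c, hz⟩)
    rcases key x hx with ⟨hx1, hx2⟩ | ⟨hx1, hx2⟩ | ⟨hx0, hx1, hx2⟩ <;>
      rcases key y hy with ⟨hy1, hy2⟩ | ⟨hy1, hy2⟩ | ⟨hy0, hy1, hy2⟩
    · rw [hx1, hy1]
    · exact absurd hx2 (h₁₂ l i hy2)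
    · exact absurd hy2 (h₂ l i hx2 y hy0 hy1)
    · exact absurd hy2 (h₁₂ l i hx2)
    · rw [hx1, hy1]
    · exact absurd hy2 (h₁ l i hx2 y hy0 hy1)
    · exact absurd hx2 (h₂ l i hy2 x hx0 hx1)
    · exact absurd hx2 (h₁ l i hy2 x hx0 hx1)
    · exact h.uniq x y l i hx2 hy2

theorem occupiedCount_update_one_le [Fintype ι] {j : ι} {q₁ : ℕ → ℕ} {F₁ : ℕ → ℕ → Prop} {i : ℕ}
    (h : Occupied (q j) (F j) i → Occupied q₁ F₁ i) :
    occupiedCount q F i ≤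
      occupiedCount (Function.update q j q₁) (Function.update F j F₁) i := by
  refine Finset.card_le_card fun x hx => ?_
  simp only [Finset.mem_filter, Finset.mem_univ, true_and] at hx ⊢
  by_cases hxj : x = j
  · subst hxj; simpa using h hx
  · simpa [hxj] using hx

/-- If occupancy is not preserved in each of the two columns, then a single square of the row has
passed from one to the other, and transposing `j` and `k` injects the old occupied columns into the
new ones. -/
theorem occupiedCount_update_two_le [Fintype ι] {j k : ι} (hjk : k ≠ j) {q₁ q₂ : ℕ → ℕ}
    {F₁ F₂ : ℕ → ℕ → Prop} {i : ℕ}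
    (h : Occupied (q j) (F j) i → Occupied (q k) (F k) i → Occupied q₁ F₁ i ∧ Occupied q₂ F₂ i)
    (h' : Occupied (q j) (F j) i ∨ Occupied (q k) (F k) i → Occupied q₁ F₁ i ∨ Occupied q₂ F₂ i) :
    occupiedCount q F i ≤ occupiedCount (Function.update (Function.update q j q₁) k q₂)
      (Function.update (Function.update F j F₁) k F₂) i := by
  have hother : ∀ x, x ≠ j → x ≠ k → (Occupied (q x) (F x) i ↔
      Occupied (Function.update (Function.update q j q₁) k q₂ x)
        (Function.update (Function.update F j F₁) k F₂ x) i) := fun x hx hx' => by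
    simp [hx, hx']
  have hj : Occupied q₁ F₁ i ↔ Occupied (Function.update (Function.update q j q₁) k q₂ j)
        (Function.update (Function.update F j F₁) k F₂ j) i := by
    simp [hjk.symm]
  have hk : Occupied q₂ F₂ i ↔ Occupied (Function.update (Function.update q j q₁) k q₂ k)
        (Function.update (Function.update F j F₁) k F₂ k) i := by
    simp
  rw [hj, hk] at h h'
  unfold occupiedCount
  generalize Function.update (Function.update q j q₁) k q₂ = q' at *
  generalize Function.update (Function.update F j F₁) k F₂ = F' at *
  by_cases hc : (Occupied (q j) (F j) i → Occupied (q' j) (F' j) i) ∧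
      (Occupied (q k) (F k) i → Occupied (q' k) (F' k) i)
  · refine Finset.card_le_card fun x hx => ?_
    simp only [Finset.mem_filter, Finset.mem_univ, true_and] at hx ⊢
    by_cases c : x = j
    · subst c; exact hc.1 hx
    by_cases c' : x = k
    · subst c'; exact hc.2 hx
    exact (hother x c c').1 hx
  · refine Finset.card_le_card_of_injOn (Equiv.swap j k) (fun x hx => ?_)
      (Equiv.swap j k).injective.injOn
    simp only [Finset.coe_filter, Finset.mem_univ, true_and, Set.mem_ofPred_eq] at hx ⊢
    by_cases c : x = j
    · subst c
      rw [Equiv.swap_apply_left]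
      tauto
    by_cases c' : x = k
    · subst c'
      rw [Equiv.swap_apply_right]
      tauto
    rw [Equiv.swap_apply_of_ne_of_ne c c']
    exact (hother x c c').1 hx

theorem IsFull.update {a : ι} {m : ℕ} (h : IsFull p q F a m) {j : ι} (ha : a ≠ j)
    (q₁ : ℕ → ℕ) (F₁ : ℕ → ℕ → Prop) :
    IsFull p (Function.update q j q₁) (Function.update F j F₁) a m := by
  refine ⟨fun l hl => ?_, fun l i hl => ?_, fun i => ?_⟩
  · simpa [ha] using h.live l hl
  · simpa [ha] using h.not_dead l i hl
  · simpa [ha] using h.dead_iff i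

variable [Fintype ι]

open Classical in
/-- Unless column `j` can be filled at once, the number of its dead squares of level `m` can be
increased. -/
theorem IsConfig.exists_more_dead (h : IsConfig p n q F) (hp : ∀ j, StrictMono (p j))
    {B : List (ι × ℕ)} {j : ι} {m : ℕ}
    (hB : ∀ b ∈ B, IsFull p q F b.1 b.2) (hg : IsGreedyStep p n B j m)
    (hbad : q j (m + 1) ≤ p j m ∨ ∃ k i, k ≠ j ∧ F k m i) :
    ∃ q' F', IsConfig p n q' F' ∧ (∀ b ∈ B, IsFull p q' F' b.1 b.2) ∧
      (∀ i < n, occupiedCount q F i ≤ occupiedCount q' F' i) ∧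
      (∀ i, F j m i → F' j m i) ∧ ∃ i, F' j m i ∧ ¬ F j m i := by
  have hdj : ∀ l i, m < l → ¬ F j l i := fun l i hl hF =>
    h.not_dead_of_blocked hB hg hl ((h.column j).dead_lt hF) hg.notMem i hF
  by_cases hc : q j (m + 1) ≤ p j m
  · have hFj : ¬ F j m (q j (m + 1)) := fun hF => by
      have := (h.column j).dead _ _ hF
      omega
    by_cases hk : ∃ k, F k m (q j (m + 1))
    · obtain ⟨k, hk⟩ := hk
      have hkj : k ≠ j := by rintro rfl; exact hFj hk
      have hkB := h.ne_of_dead hB hg hk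
      have hpk := (h.column k).dead_lt hk
      obtain ⟨q₁, q₂, F₁, F₂, c₁, c₂, d₁, d₂, d₁₂, e₁, e₂, o₁, o₂⟩ :=
        (h.column j).exchange_below (h.column k) (hg.le k hkj hkB hpk) hdj
          (fun l i hl hpl => h.not_dead_of_blocked hB hg hl hpl hkB i) hk
      refine ⟨_, _, h.update_two hkj c₁ c₂ ?_ ?_ ?_, ?_, ?_, ?_, q j (m + 1), ?_, hFj⟩
      · intro l i h1 h2
        obtain ⟨h3, h4⟩ := d₁₂ l i h1 h2
        exact hkj (h.uniq _ _ _ _ h4 h3)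
      · intro l i h1 x hx hx' h2
        rcases d₁ l i h1 with h3 | h3
        · exact hx (h.uniq _ _ _ _ h2 h3)
        · exact hx' (h.uniq _ _ _ _ h2 h3)
      · intro l i h1 x hx hx' h2
        exact hx' (h.uniq _ _ _ _ h2 (d₂ l i h1))
      · exact fun b hb => ((hB b hb).update (hg.notMem b hb) _ _).update (hkB b hb) _ _
      · exact fun i hi => occupiedCount_update_two_le hkj (o₁ i hi) (o₂ i hi)
      · intro i hF
        simpa [hkj.symm] using e₁ i hF
      · simpa [hkj.symm] using e₂
    · push Not at hk
      obtain ⟨q₁, c₁, o₁⟩ := (h.column j).push (hp j) hc hdj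
      refine ⟨_, _, h.update_one c₁ ?_, ?_, ?_, ?_, q j (m + 1), ?_, hFj⟩
      · rintro l i (hF | ⟨rfl, rfl⟩) x hx hFx
        · exact hx (h.uniq _ _ _ _ hFx hF)
        · exact hk x hFx
      · exact fun b hb => (hB b hb).update (hg.notMem b hb) _ _
      · exact fun i _ => occupiedCount_update_one_le (o₁ i)
      · intro i hF
        simp [hF]
      · simp
  · obtain ⟨k₀, i₀, hk₀, hF₀⟩ := hbad.resolve_left hc
    -- The exchange creates new dead squares of level `m` from row `min (q k (m + 1)) (p j m + 1)`
    -- on. With this row maximal, the dead squares of level `m` in all other columns lie strictly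
    -- above it, so none conflicts.
    obtain ⟨k, hkmem, hkmax⟩ := Finset.exists_max_image
      (Finset.univ.filter fun k => k ≠ j ∧ ∃ i, F k m i)
      (fun k => min (q k (m + 1)) (p j m + 1)) ⟨k₀, by simpa using ⟨hk₀, i₀, hF₀⟩⟩
    simp only [Finset.mem_filter, Finset.mem_univ, true_and] at hkmem hkmax
    obtain ⟨hkj, i₁, hF₁⟩ := hkmem
    have hkB := h.ne_of_dead hB hg hF₁
    have hpk := (h.column k).dead_lt hF₁
    have hple := hg.le k hkj hkB hpk
    obtain ⟨q₁, q₂, F₁, F₂, c₁, c₂, d₁, d₂, d₁₂, e₁, o₁, o₂⟩ :=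
      (h.column j).exchange_above (h.column k) (hp j) (fun l _ => hple l)
        (hg.eq_or k hkj hkB hpk) hg.lt (by omega) rfl
        (fun l i h1 h2 => hkj (h.uniq _ _ _ _ h2 h1)) hdj
    refine ⟨_, _, h.update_two hkj c₁ c₂ d₁₂ ?_ ?_, ?_, ?_, ?_, i₁, ?_, ?_⟩
    · intro l i h1 x hx hx' h2
      rcases d₁ l i h1 with h3 | h3 | ⟨rfl, h3⟩
      · exact hx (h.uniq _ _ _ _ h2 h3)
      · exact hx' (h.uniq _ _ _ _ h2 h3)
      · have h4 := hkmax x ⟨hx, i, h2⟩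
        have h5 := (h.column x).dead _ _ h2
        have h6 := hg.le x hx (h.ne_of_dead hB hg h2) ((h.column x).dead_lt h2) l
        omega
    · intro l i h1 x hx hx' h2
      rcases d₂ l i h1 with h3 | h3
      · exact hx (h.uniq _ _ _ _ h2 h3)
      · exact hx' (h.uniq _ _ _ _ h2 h3)
    · exact fun b hb => ((hB b hb).update (hg.notMem b hb) _ _).update (hkB b hb) _ _
    · exact fun i _ => occupiedCount_update_two_le hkj (o₁ i) (o₂ i)
    · intro i hF
      simpa [hkj.symm] using e₁ i (Or.inl hF)
    · simpa [hkj.symm] using e₁ i₁ (Or.inr hF₁)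
    · exact fun hF => hkj (h.uniq _ _ _ _ hF₁ hF)

/-- If no other column has dead squares of level `m` and the live squares of column `j` after
the `m`-th one lie below the initial row of the latter, then column `j` can be filled. -/
theorem IsConfig.fill (h : IsConfig p n q F) (hp : ∀ j, StrictMono (p j))
    {B : List (ι × ℕ)} {j : ι} {m : ℕ}
    (hB : ∀ b ∈ B, IsFull p q F b.1 b.2) (hg : IsGreedyStep p n B j m)
    (hq : p j m < q j (m + 1)) (hF : ∀ k i, k ≠ j → ¬ F k m i) :
    ∃ q' F', IsConfig p n q' F' ∧ (∀ b ∈ B, IsFull p q' F' b.1 b.2) ∧ IsFull p q' F' j m ∧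
      (∀ i < n, occupiedCount q F i ≤ occupiedCount q' F' i) := by
  have hdj : ∀ l i, m < l → ¬ F j l i := fun l i hl hF =>
    h.not_dead_of_blocked hB hg hl ((h.column j).dead_lt hF) hg.notMem i hF
  -- All rows down to `p j m` become occupied. The rows below contain only live squares of levels
  -- after `m`, which are kept.
  obtain ⟨r, a, b⟩ := exists_eq_le_eq_gt m id (q j)
  simp only [id] at a
  have hj := h.column j
  have c : IsColumn (p j) n r (fun l i => l = m ∧ m < i ∧ i ≤ p j m) := by
    refine ⟨fun l => ?_, fun l => ?_, fun l hl => ?_, ?_⟩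
    · have := hj.lt_succ l
      have := a l
      have := b l
      have := a (l + 1)
      have := b (l + 1)
      have := hj.self_le (l + 1)
      omega
    · have := hj.le l
      have := hj.self_le l
      have := a l
      have := b l
      omega
    · have h3 : m < l := (hp j).lt_iff_lt.1 (by have := hg.lt; omega)
      rw [b l h3]
      exact hj.fix l hl
    · rintro l i ⟨rfl, h1, h2⟩
      have := a l le_rfl
      have := b (l + 1) (by omega)
      omega
  refine ⟨_, _, h.update_one c ?_, ?_, ⟨?_, ?_, ?_⟩, ?_⟩
  · rintro l i ⟨rfl, -⟩ x hx
    exact hF x i hx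
  · exact fun b hb => (hB b hb).update (hg.notMem b hb) _ _
  · intro l hl
    simpa using a l hl
  · intro l i hl
    simp [hl.ne]
  · simp
  · refine fun i _ => occupiedCount_update_one_le ?_
    rintro ⟨l, hl⟩
    by_cases h1 : i ≤ p j m
    · by_cases h2 : i ≤ m
      · exact ⟨i, Or.inl (a i h2)⟩
      · exact ⟨m, Or.inr ⟨rfl, by omega, h1⟩⟩
    · have h2 : i ≤ p j l := by
        rcases hl with hl | hl
        · rw [← hl]; exact hj.le l
        · exact (hj.dead _ _ hl).2.1
      have h3 : m < l := (hp j).lt_iff_lt.1 (by omega)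
      exact ⟨l, Or.inl (by rw [b l h3]; exact hl.resolve_right (hdj l i h3))⟩

theorem IsConfig.exists_full (h : IsConfig p n q F) (hp : ∀ j, StrictMono (p j))
    {B : List (ι × ℕ)} {j : ι} {m : ℕ}
    (hB : ∀ b ∈ B, IsFull p q F b.1 b.2) (hg : IsGreedyStep p n B j m) :
    ∃ q' F', IsConfig p n q' F' ∧ (∀ b ∈ B, IsFull p q' F' b.1 b.2) ∧ IsFull p q' F' j m ∧
      (∀ i < n, occupiedCount q F i ≤ occupiedCount q' F' i) := by
  classical
  -- Dead squares of level `m` lie above row `n`, so their number cannot grow forever.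
  obtain ⟨N, hN⟩ : ∃ N, N = n - ((Finset.range n).filter (F j m)).card := ⟨_, rfl⟩
  induction N using Nat.strong_induction_on generalizing q F with
  | _ N ih =>
    by_cases hbad : q j (m + 1) ≤ p j m ∨ ∃ k i, k ≠ j ∧ F k m i
    · obtain ⟨q', F', h', hB', hd, hF, i, hi, hi'⟩ := h.exists_more_dead hp hB hg hbad
      have hlt : ((Finset.range n).filter (F j m)).card <
          ((Finset.range n).filter (F' j m)).card := by
        refine Finset.card_lt_card (Finset.ssubset_iff_of_subset ?_ |>.2 ⟨i, ?_, ?_⟩)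
        · exact Finset.monotone_filter_right _ fun i _ => hF i
        · have := (h'.column j).dead _ _ hi
          have := hg.lt
          simp only [Finset.mem_filter, Finset.mem_range]
          exact ⟨by omega, hi⟩
        · simp [hi']
      have hle : ((Finset.range n).filter (F' j m)).card ≤ n := by
        simpa using Finset.card_filter_le (Finset.range n) (F' j m)
      obtain ⟨q'', F'', h'', hB'', hfull, hd'⟩ := ih _ (by omega) h' hB' rfl
      exact ⟨q'', F'', h'', hB'', hfull, fun i hi => (hd i hi).trans (hd' i hi)⟩
    · push Not at hbad
      exact h.fill hp hB hg hbad.1 hbad.2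

theorem IsConfig.exists_all_full (h : IsConfig p n q F) (hp : ∀ j, StrictMono (p j))
    (A : List (ι × ℕ))
    (hA : ∀ B j m R, A = B ++ (j, m) :: R → IsGreedyStep p n B j m) :
    ∃ q' F', IsConfig p n q' F' ∧ (∀ b ∈ A, IsFull p q' F' b.1 b.2) ∧
      (∀ i < n, occupiedCount q F i ≤ occupiedCount q' F' i) := by
  induction A using List.reverseRecOn with
  | nil => exact ⟨q, F, h, by simp, fun _ _ => le_rfl⟩
  | append_singleton A a ih =>
    obtain ⟨q', F', h', hB', hd⟩ := ih fun B j m R hBR =>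
      hA B j m (R ++ [a]) (by rw [hBR]; simp)
    obtain ⟨q'', F'', h'', hB'', hfull, hd'⟩ := h'.exists_full hp hB' (hA A a.1 a.2 [] rfl)
    refine ⟨q'', F'', h'', fun b hb => ?_, fun i hi => (hd i hi).trans (hd' i hi)⟩
    rcases List.mem_append.1 hb with hb | hb
    · exact hB'' b hb
    · obtain rfl := List.mem_singleton.1 hb
      exact hfull

end

/-! ### Rows and levels in the Rothe diagram of a vexillary permutation -/

theorem nth_le_nth_of_imp {p q : ℕ → Prop} (hp : (Set.ofPred p).Infinite) {l : ℕ}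
    (h : ∀ i ≤ Nat.nth p l, p i → q i) : Nat.nth q l ≤ Nat.nth p l := by
  classical
  have h1 : l < Nat.count q (Nat.nth p l + 1) := by
    refine lt_of_lt_of_le ?_ (Nat.count_mono_left fun k hk => h k (by omega))
    rw [Nat.count_succ, Nat.count_nth_of_infinite hp, if_pos (Nat.nth_mem_of_infinite hp l)]
    omega
  have := Nat.nth_lt_of_lt_count h1
  omega

theorem nth_succ_le {p : ℕ → Prop} {l i : ℕ}
    (h : Nat.nth p l < i) (hi : p i) : Nat.nth p (l + 1) ≤ i := by
  by_contra hc
  have := Nat.le_nth_of_lt_nth_succ (not_le.1 hc) hi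
  omega

section Columns

variable {n : ℕ} (w : Equiv.Perm (Fin n))

/-- The rows of the squares of `D(w)` in column `j`, continued by all rows below the grid. -/
def ColumnRow (j : Fin n) (i : ℕ) : Prop :=
  n ≤ i ∨ ∃ h : i < n, ((⟨i, h⟩, j) : Square n n) ∈ rotheDiagram w

/-- The row of the square of level `l` of `D(w)` in column `j`; the levels in a column are counted
from the top, starting at `0`. -/
noncomputable def levelRow (j : Fin n) (l : ℕ) : ℕ := Nat.nth (ColumnRow w j) l

open Classical in
/-- The level of a square of `D(w)`. -/
noncomputable def level (x : Square n n) : ℕ := Nat.count (ColumnRow w x.2) x.1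

theorem columnRow_infinite (j : Fin n) : (Set.ofPred (ColumnRow w j)).Infinite :=
  (Set.Ici_infinite n).mono fun _ hi => Or.inl hi

theorem levelRow_strictMono (j : Fin n) : StrictMono (levelRow w j) :=
  Nat.nth_strictMono (columnRow_infinite w j)

variable {w}

theorem mem_rotheDiagram {x : Square n n} :
    x ∈ rotheDiagram w ↔ x.1 < w.symm x.2 ∧ x.2 < w x.1 := by
  simp [rotheDiagram]

theorem columnRow_of_mem {x : Square n n} (hx : x ∈ rotheDiagram w) : ColumnRow w x.2 x.1 :=
  Or.inr ⟨x.1.2, hx⟩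

theorem levelRow_mem {j : Fin n} {l : ℕ} (h : levelRow w j l < n) :
    ((⟨levelRow w j l, h⟩, j) : Square n n) ∈ rotheDiagram w := by
  rcases Nat.nth_mem_of_infinite (columnRow_infinite w j) l with h1 | ⟨_, h1⟩
  · exact absurd h (not_lt.2 h1)
  · exact h1

theorem levelRow_level {x : Square n n} (hx : x ∈ rotheDiagram w) :
    levelRow w x.2 (level w x) = x.1 := by
  classical
  exact Nat.nth_count (columnRow_of_mem hx)

theorem level_levelRow {j : Fin n} {l : ℕ} (h : levelRow w j l < n) :
    level w (⟨levelRow w j l, h⟩, j) = l :=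
  (levelRow_strictMono w j).injective (levelRow_level (levelRow_mem h))

/-- The rows above `i` split according to whether `w k < j`. Those with `w k < j` count the rank;
the others have `w k > j` because `k < i < w⁻¹ j`, and are exactly the rows of the squares above
`(i, j)`. -/
theorem rotheRank_add_level {x : Square n n} (hx : x ∈ rotheDiagram w) :
    rotheRank w x + level w x = x.1 := by
  classical
  obtain ⟨i, j⟩ := x
  have hij := mem_rotheDiagram.1 hx
  have h1 : level w (i, j) =
      (Finset.univ.filter fun k : Fin n => k < i ∧ ¬ w k < j).card := by
    rw [level, Nat.count_eq_card_filter_range]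
    symm
    refine Finset.card_bij (fun k _ => (k : ℕ)) ?_ ?_ ?_
    · intro k hk
      simp only [Finset.mem_filter, Finset.mem_univ, true_and, Finset.mem_range] at hk ⊢
      refine ⟨hk.1, Or.inr ⟨k.2, mem_rotheDiagram.2 ⟨hk.1.trans hij.1, ?_⟩⟩⟩
      refine lt_of_le_of_ne (not_lt.1 hk.2) fun he => ?_
      have : w.symm j = k := by rw [w.symm_apply_eq]; exact he
      rw [this] at hij
      exact absurd (hk.1.trans hij.1) (lt_irrefl _)
    · intro a _ b _ hab
      exact Fin.ext hab
    · intro k hk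
      simp only [Finset.mem_filter, Finset.mem_range] at hk
      rcases hk.2 with h2 | ⟨h2, h3⟩
      · have := i.2
        omega
      · refine ⟨⟨k, h2⟩, ?_, rfl⟩
        simp only [Finset.mem_filter, Finset.mem_univ, true_and]
        exact ⟨hk.1, not_lt.2 (mem_rotheDiagram.1 h3).2.le⟩
  rw [h1, rotheRank]
  have h2 := Finset.card_filter_add_card_filter_not
    (s := Finset.univ.filter fun k : Fin n => k < i) (fun k => w k < j)
  rw [Finset.filter_filter, Finset.filter_filter] at h2
  rw [h2, ← Fin.card_Iio i]
  congr 1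
  ext k
  simp

theorem rotheLinked_iff {x y : Square n n} (hx : x ∈ rotheDiagram w) (hy : y ∈ rotheDiagram w) :
    RotheLinked w x y ↔ level w x = level w y := by
  have := rotheRank_add_level hx
  have := rotheRank_add_level hy
  rw [RotheLinked]
  omega

/-- The columns of the diagram of a vexillary permutation form a chain. -/
theorem Vexillary.column_subset_or (hw : Vexillary w) (j k : Fin n) :
    (∀ i, (i, j) ∈ rotheDiagram w → (i, k) ∈ rotheDiagram w) ∨
    (∀ i, (i, k) ∈ rotheDiagram w → (i, j) ∈ rotheDiagram w) := by
  by_contra! hc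
  obtain ⟨⟨a, ha, ha'⟩, ⟨b, hb, hb'⟩⟩ := hc
  wlog hjk : j < k generalizing j k a b
  · rcases lt_or_eq_of_le (not_lt.1 hjk) with h | rfl
    · exact this k j b hb hb' a ha ha' h
    · exact ha' ha
  simp only [mem_rotheDiagram, not_and_or, not_lt] at ha ha' hb hb'
  have h1 : w.symm j ≤ b := hb'.resolve_right (not_le.2 (hjk.trans hb.2))
  have h2 : w.symm j < b := lt_of_le_of_ne h1 fun he => by
    have : j = w b := by rw [← he]; simp
    exact absurd (this ▸ hb.2) (not_lt.2 hjk.le)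
  have h3 : w a ≤ k := ha'.resolve_left (not_le.2 (ha.1.trans (h2.trans hb.1)))
  have h4 : w a < k := lt_of_le_of_ne h3 fun he => by
    have : a = w.symm k := by rw [← he]; simp
    exact absurd (ha.1.trans (h2.trans hb.1)) (by rw [this]; exact lt_irrefl _)
  -- The values in these rows are `w a`, `j`, `w b`, `k` with `j < w a < k < w b`: the pattern
  -- `2143`.
  exact hw a (w.symm j) b (w.symm k) ha.1 h2 hb.1 (by simpa using ⟨ha.2, h4, hb.2⟩)

/-- If a column `k` contains a column `j` and a square in row `a` that is not in column `j`,
then `k` has no gaps between row `a` and the last row of `j`. -/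
theorem Vexillary.mem_of_lt_of_lt (hw : Vexillary w) {j k a b r : Fin n}
    (hjk : ∀ i, (i, j) ∈ rotheDiagram w → (i, k) ∈ rotheDiagram w)
    (ha : (a, k) ∈ rotheDiagram w) (ha' : (a, j) ∉ rotheDiagram w) (hb : (b, j) ∈ rotheDiagram w)
    (har : a < r) (hrb : r < b) : (r, k) ∈ rotheDiagram w := by
  by_contra hr
  have hbk := mem_rotheDiagram.1 (hjk b hb)
  have hak := mem_rotheDiagram.1 ha
  simp only [mem_rotheDiagram, not_and_or, not_lt] at hr
  have h1 : w r ≤ k := hr.resolve_left (not_le.2 (hrb.trans hbk.1))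
  -- The column `w r` contains row `a` but not row `b`, whereas column `j` contains row `b` but not
  -- row `a`; this contradicts the chain property.
  have hac : (a, w r) ∈ rotheDiagram w := by
    rw [mem_rotheDiagram]
    exact ⟨by simpa using har, lt_of_le_of_lt h1 hak.2⟩
  have hbc : (b, w r) ∉ rotheDiagram w := by
    rw [mem_rotheDiagram]
    exact fun h => absurd h.1 (by simpa using hrb.le)
  rcases hw.column_subset_or j (w r) with h | h
  · exact hbc (h b hb)
  · exact ha' (h a hac)

theorem ColumnRow.imp {j k : Fin n} (h : ∀ i, (i, j) ∈ rotheDiagram w → (i, k) ∈ rotheDiagram w)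
    {i : ℕ} (hi : ColumnRow w j i) : ColumnRow w k i :=
  Or.imp id (fun ⟨h1, h2⟩ => ⟨h1, h _ h2⟩) hi

theorem levelRow_le_of_subset {j k : Fin n}
    (h : ∀ i, (i, j) ∈ rotheDiagram w → (i, k) ∈ rotheDiagram w) (l : ℕ) :
    levelRow w k l ≤ levelRow w j l :=
  nth_le_nth_of_imp (columnRow_infinite w j) fun _ _ => ColumnRow.imp h

/-- A difference at level `l` is caused by a square of column `k`, not below its level `l`, that
column `j` lacks. Below that square, column `k` has no gaps down to row `levelRow w j m`. The strict
inequality between the two columns persists up to level `m`, so each of these levels of column `k`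
still lies above that row. -/
theorem Vexillary.levelRow_eq_or (hw : Vexillary w) {j k : Fin n}
    (hjk : ∀ i, (i, j) ∈ rotheDiagram w → (i, k) ∈ rotheDiagram w) {m : ℕ}
    (hm : levelRow w j m < n) {l : ℕ} (hl : l ≤ m) :
    levelRow w k l = levelRow w j l ∨
      ∀ k', l ≤ k' → k' ≤ m → levelRow w k (k' + 1) = levelRow w k k' + 1 := by
  by_cases heq : levelRow w k l = levelRow w j l
  · exact Or.inl heq
  right
  have hlt : levelRow w k l < levelRow w j l :=
    lt_of_le_of_ne (levelRow_le_of_subset hjk l) heq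
  have hlj : levelRow w j l ≤ levelRow w j m := (levelRow_strictMono w j).monotone hl
  obtain ⟨a, ha, hak, haj⟩ : ∃ a ≤ levelRow w k l, ColumnRow w k a ∧ ¬ ColumnRow w j a := by
    by_contra! hc
    exact absurd (nth_le_nth_of_imp (columnRow_infinite w k) hc) (not_le.2 hlt)
  have han : a < n := by omega
  have hak' : ((⟨a, han⟩, k) : Square n n) ∈ rotheDiagram w := by
    rcases hak with h | ⟨_, h⟩
    · omega
    · exact h
  have hfill : ∀ r, levelRow w k l < r → r ≤ levelRow w j m → ColumnRow w k r := by
    intro r hr hr'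
    rcases hr'.eq_or_lt with rfl | hr'
    · exact ColumnRow.imp hjk (Or.inr ⟨hm, levelRow_mem hm⟩)
    · exact Or.inr ⟨by omega, hw.mem_of_lt_of_lt hjk hak' (fun h => haj (Or.inr ⟨han, h⟩))
        (levelRow_mem hm) (show a < r by omega) hr'⟩
  have hsucc : ∀ k', l ≤ k' → levelRow w k k' < levelRow w j m →
      levelRow w k (k' + 1) = levelRow w k k' + 1 := by
    intro k' hk' hlt'
    have h1 := levelRow_strictMono w k (Nat.lt_succ_self k')
    have h2 := (levelRow_strictMono w k).monotone hk'
    have h3 := nth_succ_le (l := k') (Nat.lt_succ_self _)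
      (hfill (levelRow w k k' + 1) (by omega) hlt')
    exact le_antisymm h3 h1
  have hform : ∀ k', l ≤ k' → k' ≤ m → levelRow w k k' < levelRow w j k' := by
    intro k' hk'
    induction k', hk' using Nat.le_induction with
    | base => exact fun _ => hlt
    | succ k' hk' ih =>
      intro hk''
      have h1 := ih (by omega)
      have h2 := (levelRow_strictMono w j) (Nat.lt_succ_self k')
      have h3 := (levelRow_strictMono w j).monotone hk''
      simp only [Nat.succ_eq_add_one] at h2
      rw [hsucc k' hk' (by omega)]
      omega
  intro k' hk' hk''
  exact hsucc k' hk' ((hform k' hk' hk'').trans_le ((levelRow_strictMono w j).monotone hk''))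

end Columns

/-! ### The greedy selection of distinguished squares -/

section Selection

variable {n : ℕ} {w : Equiv.Perm (Fin n)}

theorem prefix_foldl_selectStep (L A : List (Square n n)) : A <+: L.foldl (selectStep w) A := by
  induction L generalizing A with
  | nil => exact List.prefix_rfl
  | cons x L ih =>
    refine List.IsPrefix.trans ?_ (ih _)
    unfold selectStep
    split_ifs
    · exact List.prefix_rfl
    · exact List.prefix_append _ _

theorem foldl_selectStep_sublist (L A : List (Square n n)) :
    List.Sublist (L.foldl (selectStep w) A) (A ++ L) := by
  induction L generalizing A with
  | nil => simp
  | cons x L ih =>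
    refine (ih _).trans ?_
    unfold selectStep
    split_ifs
    · exact (List.Sublist.refl A).append (List.sublist_cons_self x L)
    · simp

theorem pairwise_foldl_selectStep (L A : List (Square n n))
    (hA : A.Pairwise fun a x => ¬ (a.2 = x.2 ∨ RotheLinked w a x)) :
    (L.foldl (selectStep w) A).Pairwise fun a x => ¬ (a.2 = x.2 ∨ RotheLinked w a x) := by
  induction L generalizing A with
  | nil => exact hA
  | cons x L ih =>
    refine ih _ ?_
    unfold selectStep
    split_ifs with h
    · exact hA
    · rw [List.pairwise_append]
      refine ⟨hA, List.pairwise_singleton _ _, fun a ha b hb => ?_⟩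
      obtain rfl := List.mem_singleton.1 hb
      exact fun hc => h ⟨a, ha, hc⟩

theorem exists_mem_foldl_selectStep (L₁ L₂ : List (Square n n)) (x : Square n n) :
    ∃ a ∈ (L₁ ++ x :: L₂).foldl (selectStep w) [], (a ∈ L₁ ∨ a = x) ∧
      (a.2 = x.2 ∨ RotheLinked w a x) := by
  rw [List.foldl_append, List.foldl_cons]
  have hpre := prefix_foldl_selectStep (w := w) L₂
    (selectStep w (L₁.foldl (selectStep w) []) x)
  by_cases h : ∃ a ∈ L₁.foldl (selectStep w) [], a.2 = x.2 ∨ RotheLinked w a x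
  · obtain ⟨a, ha, hax⟩ := h
    refine ⟨a, hpre.subset ?_, Or.inl ?_, hax⟩
    · rw [selectStep, if_pos ⟨a, ha, hax⟩]
      exact ha
    · simpa using (foldl_selectStep_sublist (w := w) L₁ []).subset ha
  · refine ⟨x, hpre.subset ?_, Or.inr rfl, Or.inl rfl⟩
    rw [selectStep, if_neg h]
    simp

theorem distinguishedSquares_sublist :
    List.Sublist (distinguishedSquares w) ((rotheDiagram w).sort (PrecEq w)) := by
  simpa [distinguishedSquares] using
    foldl_selectStep_sublist (w := w) ((rotheDiagram w).sort (PrecEq w)) []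

theorem mem_rotheDiagram_of_mem_distinguishedSquares {a : Square n n}
    (ha : a ∈ distinguishedSquares w) : a ∈ rotheDiagram w := by
  simpa using distinguishedSquares_sublist.subset ha

theorem pairwise_precEq_distinguishedSquares : (distinguishedSquares w).Pairwise (PrecEq w) :=
  ((rotheDiagram w).pairwise_sort (PrecEq w)).sublist distinguishedSquares_sublist

theorem pairwise_distinguishedSquares : (distinguishedSquares w).Pairwise
    fun a x => ¬ (a.2 = x.2 ∨ RotheLinked w a x) :=
  pairwise_foldl_selectStep _ _ List.Pairwise.nil

theorem eq_of_mem_distinguishedSquares {a b : Square n n} (ha : a ∈ distinguishedSquares w)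
    (hb : b ∈ distinguishedSquares w) (hab : a.2 = b.2 ∨ level w a = level w b) : a = b := by
  by_contra hne
  rw [← rotheLinked_iff (mem_rotheDiagram_of_mem_distinguishedSquares ha)
    (mem_rotheDiagram_of_mem_distinguishedSquares hb)] at hab
  have : Std.Symm fun a x : Square n n => ¬ (a.2 = x.2 ∨ RotheLinked w a x) := ⟨?_⟩
  · exact (pairwise_distinguishedSquares (w := w)).forall ha hb hne hab
  intro x y hxy hyx
  refine hxy (hyx.imp Eq.symm fun h => ?_)
  rw [RotheLinked] at h ⊢
  omega

/-- A rejected square was rejected because of an earlier selected one; a selected square is its own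
witness. -/
theorem exists_mem_distinguishedSquares {x : Square n n} (hx : x ∈ rotheDiagram w) :
    ∃ a ∈ distinguishedSquares w, PrecEq w a x ∧ (a.2 = x.2 ∨ level w a = level w x) := by
  obtain ⟨L₁, L₂, hL⟩ := List.append_of_mem
    (show x ∈ (rotheDiagram w).sort (PrecEq w) by simpa using hx)
  obtain ⟨a, ha, hax, hc⟩ := exists_mem_foldl_selectStep (w := w) L₁ L₂ x
  have ha' : a ∈ distinguishedSquares w := by
    rw [distinguishedSquares, hL]
    exact ha
  rw [rotheLinked_iff (mem_rotheDiagram_of_mem_distinguishedSquares ha') hx] at hc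
  refine ⟨a, ha', ?_, hc⟩
  rcases hax with hax | rfl
  · have h := (rotheDiagram w).pairwise_sort (PrecEq w)
    rw [hL, List.pairwise_append] at h
    exact h.2.2 a hax x (by simp)
  · exact Or.inl rfl

theorem PrecEq.le {x y : Square n n} (h : PrecEq w x y) : y.1 ≤ x.1 := by
  rcases h with rfl | h | h | h
  · exact le_rfl
  · exact h.le
  · exact h.1.ge
  · exact h.1.ge

theorem not_prec_self (x : Square n n) : ¬ Prec w x x := by
  simp [Prec]

/-- The distinguished squares, as pairs of a column and a level. -/
noncomputable def distinguishedLevels (w : Equiv.Perm (Fin n)) : List (Fin n × ℕ) :=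
  (distinguishedSquares w).map fun a => (a.2, level w a)

theorem mem_distinguishedLevels {j : Fin n} {m : ℕ} : (j, m) ∈ distinguishedLevels w ↔
    ∃ h : levelRow w j m < n, (⟨levelRow w j m, h⟩, j) ∈ distinguishedSquares w := by
  simp only [distinguishedLevels, List.mem_map, Prod.mk.injEq]
  constructor
  · rintro ⟨a, ha, rfl, rfl⟩
    have h := levelRow_level (mem_rotheDiagram_of_mem_distinguishedSquares ha)
    have h' : levelRow w a.2 (level w a) < n := by rw [h]; exact a.1.2
    refine ⟨h', ?_⟩
    convert ha using 2
    exact Fin.ext h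
  · rintro ⟨h, ha⟩
    exact ⟨_, ha, rfl, level_levelRow h⟩

theorem column_unique_of_mem_distinguishedLevels {j k : Fin n} {m : ℕ}
    (hj : (j, m) ∈ distinguishedLevels w) (hk : (k, m) ∈ distinguishedLevels w) : j = k := by
  obtain ⟨h, hj⟩ := mem_distinguishedLevels.1 hj
  obtain ⟨h', hk⟩ := mem_distinguishedLevels.1 hk
  have := eq_of_mem_distinguishedSquares hj hk (Or.inr (by
    rw [level_levelRow h, level_levelRow h']))
  exact congrArg Prod.snd this

theorem level_unique_of_mem_distinguishedLevels {j : Fin n} {m m' : ℕ}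
    (hj : (j, m) ∈ distinguishedLevels w) (hk : (j, m') ∈ distinguishedLevels w) : m = m' := by
  obtain ⟨h, hj⟩ := mem_distinguishedLevels.1 hj
  obtain ⟨h', hk⟩ := mem_distinguishedLevels.1 hk
  have := eq_of_mem_distinguishedSquares hj hk (Or.inl rfl)
  rw [← level_levelRow h, this, level_levelRow h']

/-- Every square preceding the new choice shares its column or its level with an earlier choice
(`hblock`). Applied to suitable squares this yields the conditions on levels, while the chain
property and the tie-breaking rule yield the conditions on initial rows. -/
theorem Vexillary.isGreedyStep (hw : Vexillary w) {B R : List (Fin n × ℕ)} {j : Fin n} {m : ℕ}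
    (hA : distinguishedLevels w = B ++ (j, m) :: R) :
    IsGreedyStep (levelRow w) n B j m := by
  obtain ⟨A₁, A₂', hA', hB, hmap⟩ := List.map_eq_append_iff.1 hA
  obtain ⟨a, A₂, rfl, ha, -⟩ := List.map_eq_cons_iff.1 hmap
  have haA : a ∈ distinguishedSquares w := by rw [hA']; simp
  have haD := mem_rotheDiagram_of_mem_distinguishedSquares haA
  obtain ⟨rfl, rfl⟩ : a.2 = j ∧ level w a = m := by simpa using ha
  set j := a.2 with hj
  set m := level w a with hm
  have hP : levelRow w j m = a.1 := levelRow_level haD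
  have hmem₁ : ∀ b ∈ A₁, b ∈ distinguishedSquares w := fun b hb => by rw [hA']; simp [hb]
  have hprec : ∀ b ∈ A₁, PrecEq w b a ∧ b.2 ≠ j ∧ level w b ≠ m := by
    intro b hb
    have h1 := pairwise_precEq_distinguishedSquares (w := w)
    have h2 := pairwise_distinguishedSquares (w := w)
    rw [hA', List.pairwise_append] at h1 h2
    have h3 := h2.2.2 b hb a (by simp)
    rw [rotheLinked_iff (mem_rotheDiagram_of_mem_distinguishedSquares (hmem₁ b hb)) haD,
      not_or] at h3
    exact ⟨h1.2.2 b hb a (by simp), h3⟩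
  have hblock : ∀ x ∈ rotheDiagram w, Prec w x a →
      ∃ b ∈ A₁, PrecEq w b x ∧ (b.2 = x.2 ∨ level w b = level w x) := by
    intro x hx hxa
    obtain ⟨b, hb, hbx, hc⟩ := exists_mem_distinguishedSquares hx
    refine ⟨b, ?_, hbx, hc⟩
    have hba : PrecEq w b a := _root_.trans hbx (Or.inr hxa)
    have hne : b ≠ a := by
      rintro rfl
      have h3 : b = x := antisymm (r := PrecEq w) hbx (Or.inr hxa)
      rw [← h3] at hxa
      exact not_prec_self _ hxa
    have h1 := pairwise_precEq_distinguishedSquares (w := w)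
    rw [hA'] at hb h1
    rw [List.pairwise_append, List.pairwise_cons] at h1
    rcases List.mem_append.1 hb with hb | hb
    · exact hb
    rcases List.mem_cons.1 hb with hb | hb
    · exact absurd hb hne
    · exact absurd (antisymm (r := PrecEq w) hba (h1.2.1.1 b hb)) hne
  have hBmem : ∀ b ∈ A₁, (b.2, level w b) ∈ B := fun b hb => by
    rw [← hB]
    exact List.mem_map.2 ⟨b, hb, rfl⟩
  have hBall : ∀ k, (∀ b ∈ B, b.1 ≠ k) → ∀ b ∈ A₁, b.2 ≠ k := fun k hk b hb =>
    hk _ (hBmem b hb)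
  have hPn : levelRow w j m < n := by rw [hP]; exact a.1.2
  have hnot : ∀ k, (∀ b ∈ B, b.1 ≠ k) → ∀ h : levelRow w k m < n,
      ¬ Prec w (⟨levelRow w k m, h⟩, k) a := by
    intro k hk h hp
    obtain ⟨b, hb, -, hc⟩ := hblock _ (levelRow_mem h) hp
    rcases hc with hc | hc
    · exact hBall k hk b hb hc
    · rw [level_levelRow h] at hc
      exact (hprec b hb).2.2 hc
  -- Suppose column `k` is contained in column `j`. Then its level `m` is not higher, and not lower
  -- by `hnot`. An additional square of `j` above that row would change the level there; one below
  -- it would give `k` fewer squares below, so that `k` would come first in the order.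
  have hsub : ∀ k, k ≠ j → (∀ b ∈ B, b.1 ≠ k) → levelRow w k m < n →
      ∀ i, (i, j) ∈ rotheDiagram w → (i, k) ∈ rotheDiagram w := by
    classical
    intro k hkj hk hkn
    rcases hw.column_subset_or j k with h | h
    · exact h
    have hle : levelRow w j m ≤ levelRow w k m := levelRow_le_of_subset h m
    have hnp := hnot k hk hkn
    have heq : levelRow w k m = levelRow w j m := by
      by_contra hne
      refine hnp (Or.inl ?_)
      rw [Fin.lt_def, ← hP]
      exact lt_of_le_of_ne hle (Ne.symm hne)
    have heq' : (⟨levelRow w k m, hkn⟩ : Fin n) = a.1 := Fin.ext (heq.trans hP)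
    intro i hi
    by_contra hik
    rcases lt_trichotomy i a.1 with c | c | c
    · have h1 : Nat.count (ColumnRow w k) a.1 = m := by
        rw [← hP, ← heq]
        exact Nat.count_nth_of_infinite (columnRow_infinite w k) m
      have h2 : Nat.count (ColumnRow w j) a.1 = m := rfl
      rw [Nat.count_eq_card_filter_range] at h1 h2
      refine absurd (h1.trans h2.symm) (ne_of_lt (Finset.card_lt_card ?_))
      refine Finset.ssubset_iff_of_subset ?_ |>.2 ⟨i, ?_, ?_⟩
      · exact Finset.monotone_filter_right _ fun r _ => ColumnRow.imp h
      · simp only [Finset.mem_filter, Finset.mem_range]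
        exact ⟨c, Or.inr ⟨i.2, hi⟩⟩
      · simp only [Finset.mem_filter, Finset.mem_range, not_and]
        rintro - (h3 | ⟨_, h3⟩)
        · have := i.2
          omega
        · exact hik h3
    · rw [c, ← heq'] at hik
      exact hik (levelRow_mem hkn)
    · refine hnp (Or.inr (Or.inl ⟨heq', ?_⟩))
      have hinj : Set.InjOn (fun y : Square n n => ((y.1, j) : Square n n))
          ((rotheDiagram w).filter fun y => y.2 = k ∧ (⟨levelRow w k m, hkn⟩ : Fin n) < y.1) := by
        intro y hy z hz hyz
        simp only [Finset.coe_filter, Set.mem_ofPred_eq] at hy hz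
        exact Prod.ext (Prod.mk.inj hyz).1 (hy.2.1.trans hz.2.1.symm)
      rw [numBelow, ← Finset.card_image_of_injOn hinj]
      refine Finset.card_lt_card (Finset.ssubset_iff_of_subset ?_ |>.2 ⟨(i, j), ?_, ?_⟩)
      · intro y hy
        simp only [Finset.mem_image, Finset.mem_filter] at hy ⊢
        obtain ⟨z, ⟨hz, hzk, hlt⟩, rfl⟩ := hy
        refine ⟨h _ ?_, rfl, by rw [← heq']; exact hlt⟩
        rw [← hzk]
        exact hz
      · simp only [Finset.mem_filter]
        exact ⟨hi, hj, c⟩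
      · simp only [Finset.mem_image, Finset.mem_filter, not_exists, not_and]
        rintro ⟨z, z'⟩ ⟨hz, hzk, -⟩ hzi
        simp only [Prod.mk.injEq, and_true] at hzi hzk
        rw [hzi, hzk] at hz
        exact hik hz
  refine ⟨hPn, ?_, fun k hkj hk hkn => levelRow_le_of_subset (hsub k hkj hk hkn),
    fun k hkj hk hkn l hl => hw.levelRow_eq_or (hsub k hkj hk hkn) hPn hl, ?_, ?_⟩
  · intro b hb
    rw [← hB] at hb
    obtain ⟨c, hc, rfl⟩ := List.mem_map.1 hb
    exact (hprec c hc).2.1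
  · intro l hl hjl k hk hkl
    have hrow := levelRow_strictMono w j hl
    have key : ∀ (y : Fin n) (h : levelRow w y l < n), levelRow w j m < levelRow w y l →
        (∀ b ∈ A₁, b.2 ≠ y) → ∃ b ∈ B, b.2 = l ∧ levelRow w y l ≤ levelRow w b.1 l := by
      intro y h hlt hy
      obtain ⟨b, hb, hbx, hc⟩ := hblock _ (levelRow_mem h) (Or.inl (by
        rw [Fin.lt_def, ← hP]
        exact hlt))
      rw [level_levelRow h] at hc
      have hbl := hc.resolve_left (hy b hb)
      refine ⟨_, hBmem b hb, hbl, ?_⟩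
      have h1 := levelRow_level (mem_rotheDiagram_of_mem_distinguishedSquares (hmem₁ b hb))
      rw [hbl] at h1
      rw [h1]
      exact hbx.le
    by_cases c : levelRow w j m < levelRow w k l
    · exact key k hkl c (hBall k hk)
    -- Here level `l` of column `k` need not precede the new choice, but level `l` of column `j`
    -- does, and it starts lower.
    · obtain ⟨b, hb, hbl, hle⟩ := key j hjl hrow fun b hb => (hprec b hb).2.1
      exact ⟨b, hb, hbl, by omega⟩
  · intro b hb
    rw [← hB] at hb
    obtain ⟨b, hb', rfl⟩ := List.mem_map.1 hb
    clear hb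
    rename' hb' => hb
    by_contra! hc
    obtain ⟨hc1, hc2⟩ := hc
    simp only at hc1 hc2
    obtain ⟨hba, hbj, hbm⟩ := hprec b hb
    have hbA := hmem₁ b hb
    have h1 := levelRow_level (mem_rotheDiagram_of_mem_distinguishedSquares hbA)
    have h2 : levelRow w b.2 (level w b) < levelRow w b.2 m :=
      levelRow_strictMono w b.2 (lt_of_le_of_ne hc1 hbm)
    have h3 : (a.1 : ℕ) ≤ b.1 := hba.le
    -- The square of level `m` in the column of `b` lies below `b`, so it precedes the new choice.
    -- Its witness can be neither in its column, since `b` is the only choice there and lies higher,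
    -- nor of level `m`.
    obtain ⟨b', hb', hb'x, hc⟩ := hblock _ (levelRow_mem hc2) (Or.inl (by
      rw [Fin.lt_def]
      simp only
      omega))
    rw [level_levelRow hc2] at hc
    rcases hc with hc | hc
    · obtain rfl := eq_of_mem_distinguishedSquares (hmem₁ b' hb') hbA (Or.inl hc)
      have h4 := hb'x.le
      rw [Fin.le_def] at h4
      simp only at h4
      omega
    · exact (hprec b' hb').2.2 hc

/-- A configuration that is full at all distinguished squares has no other dead squares. -/
theorem IsConfig.dead_iff {q : Fin n → ℕ → ℕ} {F : Fin n → ℕ → ℕ → Prop}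
    (h : IsConfig (levelRow w) n q F)
    (hfull : ∀ b ∈ distinguishedLevels w, IsFull (levelRow w) q F b.1 b.2) (j : Fin n) (l i : ℕ) :
    F j l i ↔ (j, l) ∈ distinguishedLevels w ∧ l < i ∧ i ≤ levelRow w j l := by
  refine ⟨fun hF => ?_, fun hF => ((hfull _ hF.1).dead_iff i).2 hF.2⟩
  have hn := (h.column j).dead_lt hF
  have hd := (h.column j).dead _ _ hF
  -- If `b` lies in column `j` at a later level, fullness excludes the dead square. Otherwise `b`
  -- has level `l`, and its full column has a dead square of that level in row `i`; uniqueness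
  -- identifies the columns.
  obtain ⟨b, hb, hbx, hc⟩ := exists_mem_distinguishedSquares (levelRow_mem hn)
  have hb1 := levelRow_level (mem_rotheDiagram_of_mem_distinguishedSquares hb)
  have hbA : (b.2, level w b) ∈ distinguishedLevels w := List.mem_map.2 ⟨b, hb, rfl⟩
  have hle : levelRow w j l ≤ levelRow w b.2 (level w b) := by
    rw [hb1]; exact hbx.le
  rw [level_levelRow hn] at hc
  have hself := (h.column j).self_le l
  have hcol : b.2 = j → level w b = l := by
    intro hcj
    rw [hcj] at hle
    by_contra hne
    have h1 := (levelRow_strictMono w j).le_iff_le.1 hle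
    have h2 := (hfull _ hbA).not_dead l i (lt_of_le_of_ne h1 (Ne.symm hne))
    rw [hcj] at h2
    exact h2 hF
  have hlev : level w b = l := hc.elim hcol id
  rw [hlev] at hbA hle
  have hF' : F b.2 l i := ((hfull _ hbA).dead_iff i).2 ⟨by omega, by simp only; omega⟩
  obtain rfl := h.uniq _ _ _ _ hF' hF
  exact ⟨hbA, by omega, hd.2.1⟩

end Selection

/-! ### Bubbling diagrams as configurations -/

namespace BubblingDiagram

variable {n k : ℕ}

/-- The bubbling diagram with live squares `(q j l, j)` and with dead squares given by `F`, where
the rank of a square is its row minus its level. -/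
structure Represents (𝒟 : BubblingDiagram n k) (q : Fin k → ℕ → ℕ)
    (F : Fin k → ℕ → ℕ → Prop) : Prop where
  mem_D : ∀ (i : Fin n) j, (i, j) ∈ 𝒟.D ↔ Occupied (q j) (F j) i
  mem_F : ∀ (i : Fin n) j, (i, j) ∈ 𝒟.F ↔ ∃ l, F j l i
  rank : ∀ (i : Fin n) j l, q j l = i ∨ F j l i → 𝒟.r (i, j) + l = i

theorem ext_of_eq {𝒟 𝒟' : BubblingDiagram n k} (hD : 𝒟.D = 𝒟'.D) (hF : 𝒟.F = 𝒟'.F)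
    (hr : ∀ x ∈ 𝒟.D, 𝒟.r x = 𝒟'.r x) : 𝒟 = 𝒟' := by
  have hr' : 𝒟.r = 𝒟'.r := by
    funext x
    by_cases hx : x ∈ 𝒟.D
    · exact hr x hx
    · rw [𝒟.r_off x hx, 𝒟'.r_off x (hD ▸ hx)]
  cases 𝒟
  cases 𝒟'
  simp only at hD hF hr'
  subst hD hF hr'
  rfl

theorem BubblingMove.unique {𝒟 𝒟₁ 𝒟₂ : BubblingDiagram n k} {i : Fin n} {j : Fin k}
    (h₁ : BubblingMove 𝒟 i j 𝒟₁) (h₂ : BubblingMove 𝒟 i j 𝒟₂) : 𝒟₁ = 𝒟₂ := by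
  obtain ⟨-, a, ha, -, hD₁, hr₁, hs₁, hF₁⟩ := h₁
  obtain ⟨-, b, hb, -, hD₂, hr₂, hs₂, hF₂⟩ := h₂
  obtain rfl : a = b := Fin.ext (by omega)
  refine ext_of_eq (hD₁.trans hD₂.symm) (hF₁.trans hF₂.symm) fun x hx => ?_
  by_cases hxa : x = (a, j)
  · subst hxa; omega
  · rw [hs₁ x hx hxa, hs₂ x (by rw [hD₂, ← hD₁]; exact hx) hxa]

theorem KBubblingMove.unique {𝒟 𝒟₁ 𝒟₂ : BubblingDiagram n k} {i : Fin n} {j : Fin k}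
    (h₁ : KBubblingMove 𝒟 i j 𝒟₁) (h₂ : KBubblingMove 𝒟 i j 𝒟₂) : 𝒟₁ = 𝒟₂ := by
  obtain ⟨-, -, a, ha, -, hD₁, hr₁, hs₁, hF₁⟩ := h₁
  obtain ⟨-, -, b, hb, -, hD₂, hr₂, hs₂, hF₂⟩ := h₂
  obtain rfl : a = b := Fin.ext (by omega)
  refine ext_of_eq (hD₁.trans hD₂.symm) (hF₁.trans hF₂.symm) fun x hx => ?_
  by_cases hxa : x = (a, j)
  · subst hxa; omega
  · rw [hs₁ x hx hxa, hs₂ x (by rw [hD₂, ← hD₁]; exact hx) hxa]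

variable {p q q' : Fin k → ℕ → ℕ} {F F' : Fin k → ℕ → ℕ → Prop} {𝒟 𝒟' : BubblingDiagram n k}

theorem Represents.unique (h : Represents 𝒟 q F) (h' : Represents 𝒟' q F) : 𝒟 = 𝒟' := by
  refine ext_of_eq ?_ ?_ ?_
  · ext ⟨i, j⟩
    rw [h.mem_D, h'.mem_D]
  · ext ⟨i, j⟩
    rw [h.mem_F, h'.mem_F]
  · rintro ⟨i, j⟩ hx
    obtain ⟨l, hl⟩ := (h.mem_D i j).1 hx
    have := h.rank i j l hl
    have := h'.rank i j l hl
    omega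

theorem Represents.mem_live (h : Represents 𝒟 q F) (hc : IsConfig p n q F) (i : Fin n)
    (j : Fin k) : (i, j) ∈ 𝒟.live ↔ ∃ l, q j l = i := by
  rw [live, Finset.mem_sdiff, h.mem_D, h.mem_F]
  constructor
  · rintro ⟨⟨l, hl | hl⟩, h2⟩
    · exact ⟨l, hl⟩
    · exact absurd ⟨l, hl⟩ h2
  · rintro ⟨l, hl⟩
    refine ⟨⟨l, Or.inl hl⟩, ?_⟩
    rintro ⟨l', hl'⟩
    rw [← hl] at hl'
    exact (hc.column j).not_dead_live hl'

theorem exists_represents (hc : IsConfig p n q F) : ∃ 𝒟 : BubblingDiagram n k, Represents 𝒟 q F := by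
  classical
  -- The level of an occupied square is unique and at most its row, so neither the choice nor the
  -- truncated subtraction matters.
  let r : Square n k → ℕ := fun x =>
    if h : ∃ l, q x.2 l = x.1 ∨ F x.2 l x.1 then x.1 - h.choose else 0
  have hr : ∀ (i : Fin n) j l, q j l = i ∨ F j l i → r (i, j) + l = i := by
    intro i j l hl
    have hex : ∃ l, q j l = i ∨ F j l i := ⟨l, hl⟩
    have h1 : r (i, j) = i - hex.choose := dif_pos hex
    have h2 := (hc.column j).level_unique hex.choose_spec hl
    have h3 := (hc.column j).self_le l
    have h4 : q j l ≤ i := by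
      rcases hl with hl | hl
      · exact hl.le
      · exact ((hc.column j).dead _ _ hl).1.le
    omega
  refine ⟨⟨Finset.univ.filter fun x => Occupied (q x.2) (F x.2) x.1, r,
    Finset.univ.filter fun x => ∃ l, F x.2 l x.1, fun x hx => ?_, fun x hx => ?_,
    fun i j hij => ?_, fun i j j' hne hij hij' => ?_⟩, fun i j => ?_, fun i j => ?_, hr⟩
  · simp only [Finset.mem_filter, Finset.mem_univ, true_and] at hx
    exact dif_neg hx
  · simp only [Finset.mem_filter, Finset.mem_univ, true_and] at hx ⊢
    exact hx.imp fun l hl => Or.inr hl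
  · simp only [Finset.mem_filter, Finset.mem_univ, true_and] at hij
    obtain ⟨l, hl⟩ := hij
    have hd := (hc.column j).dead _ _ hl
    have hi := i.2
    refine ⟨⟨q j l, by omega⟩, hd.1, ?_, ?_, ?_⟩
    · simp only [Finset.mem_sdiff, Finset.mem_filter, Finset.mem_univ, true_and]
      refine ⟨⟨l, Or.inl rfl⟩, ?_⟩
      rintro ⟨l', hl'⟩
      exact (hc.column j).not_dead_live hl'
    · intro i' h1 h2
      simp only [Finset.mem_sdiff, Finset.mem_filter, Finset.mem_univ, true_and, not_and, not_not]
      rintro ⟨l', hl' | hl'⟩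
      · rw [Fin.lt_def] at h1 h2
        simp only at h1
        have h3 := (hc.column j).strictMono.lt_iff_lt.1 (show q j l < q j l' by omega)
        have h4 := (hc.column j).strictMono.lt_iff_lt.1 (show q j l' < q j (l + 1) by omega)
        omega
      · exact ⟨l', hl'⟩
    · have h1 := hr i j l (Or.inr hl)
      have h2 := hr ⟨q j l, by omega⟩ j l (Or.inl rfl)
      simp only at h2 ⊢
      omega
  · simp only [Finset.mem_filter, Finset.mem_univ, true_and] at hij hij'
    obtain ⟨l, hl⟩ := hij
    obtain ⟨l', hl'⟩ := hij'
    intro he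
    have h1 := hr i j l (Or.inr hl)
    have h2 := hr i j' l' (Or.inr hl')
    obtain rfl : l = l' := by omega
    exact hne (hc.uniq _ _ _ _ hl hl')
  · simp
  · simp

/-- Since row `a` is free, the moved square stays below the previous live square and its dead
squares. The vacated row may be dead in `G` or not, so both kinds of moves are covered. -/
theorem _root_.IsColumn.moveUp {p q : ℕ → ℕ} {F G : ℕ → ℕ → Prop} (h : IsColumn p n q F)
    {l a : ℕ} (ha : a + 1 = q l) (hn : q l < n) (hfree : ¬ Occupied q F a)
    (hG : ∀ l' i, G l' i → F l' i ∨ (l' = l ∧ i = q l)) :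
    IsColumn p n (Function.update q l a) G := by
  have hother : ∀ l', l' ≠ l → Function.update q l a l' = q l' := fun l' hl' =>
    Function.update_of_ne hl' _ _
  have hself : Function.update q l a l = a := Function.update_self ..
  have hle := h.le l
  refine ⟨fun l' => ?_, fun l' => ?_, fun l' hl' => ?_, fun l' i hi => ?_⟩
  · have h1 := h.lt_succ l'
    by_cases c : l' = l
    · subst c
      rw [hself, hother _ (by omega)]
      omega
    · rw [hother l' c]
      by_cases c' : l' + 1 = l
      · subst c'
        rw [hself]
        have : q l' ≠ a := fun he => hfree ⟨l', Or.inl he⟩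
        omega
      · rw [hother _ c']
        exact h1
  · by_cases c : l' = l
    · subst c
      omega
    · rw [hother l' c]
      exact h.le l'
  · by_cases c : l' = l
    · subst c
      have := h.fix l' hl'
      omega
    · rw [hother l' c]
      exact h.fix l' hl'
  · rcases hG l' i hi with hF | ⟨rfl, rfl⟩
    · have hd := h.dead _ _ hF
      have hia : i ≠ a := fun he => hfree ⟨l', Or.inr (he ▸ hF)⟩
      by_cases c : l' = l
      · subst c
        rw [hself, hother _ (by omega)]
        omega
      · rw [hother l' c]
        by_cases c' : l' + 1 = l
        · subst c'
          rw [hself]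
          omega
        · rw [hother _ c']
          exact hd
    · have := h.lt_succ l'
      rw [hself, hother _ (by omega)]
      omega

/-- Since the result of the move is again a column, row `a` holds no second square. Freeness of the
target thus need not be assumed when a move is built from two configurations. -/
theorem not_occupied_of_update {p q : ℕ → ℕ} {F G : ℕ → ℕ → Prop} {l a : ℕ}
    (hne : q l ≠ a) (h : IsColumn p n (Function.update q l a) G) (hFG : ∀ l' i, F l' i → G l' i) :
    ¬ Occupied q F a := by
  have hself : Function.update q l a l = a := Function.update_self ..
  rintro ⟨l', hl' | hl'⟩
  · have hne' : l' ≠ l := by rintro rfl; exact hne hl'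
    refine hne' (h.strictMono.injective ?_)
    rw [hself, Function.update_of_ne hne', hl']
  · have := hFG _ _ hl'
    rw [← hself] at this
    exact h.not_dead_live this

theorem Represents.bubblingMove (h : Represents 𝒟 q F) (hc : IsConfig p n q F)
    (h' : Represents 𝒟' q' F) (hc' : IsConfig p n q' F) {j : Fin k} {l a : ℕ} {i : Fin n}
    (hi : q j l = i) (ha : a + 1 = i) (hq : q' = Function.update q j (Function.update (q j) l a)) :
    BubblingMove 𝒟 i j 𝒟' := by
  have hin := i.2
  have hqj : q' j = Function.update (q j) l a := by rw [hq, Function.update_self]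
  have hql : q' j l = a := by rw [hqj, Function.update_self]
  have hqo : ∀ l', l' ≠ l → q' j l' = q j l' := fun l' hl' => by
    rw [hqj, Function.update_of_ne hl']
  have hqx : ∀ x, x ≠ j → q' x = q x := fun x hx => by rw [hq, Function.update_of_ne hx]
  have hcol := hc'.column j
  have hfree : ¬ Occupied (q j) (F j) a := by
    rw [hqj] at hcol
    exact not_occupied_of_update (by omega) hcol fun _ _ => id
  refine ⟨(h.mem_live hc i j).2 ⟨l, hi⟩, ⟨a, by omega⟩, ha, ?_, ?_, ?_, ?_, ?_⟩
  · rw [h.mem_D]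
    exact hfree
  · ext ⟨x, y⟩
    rw [Finset.mem_insert, Finset.mem_erase, h.mem_D, h'.mem_D]
    by_cases hy : y = j
    · subst hy
      simp only [Prod.mk.injEq, and_true, ne_eq, Fin.ext_iff]
      constructor
      · rintro ⟨l', hl'⟩
        by_cases c : l' = l
        · subst c
          rcases hl' with hl' | hl'
          · exact Or.inl (by omega)
          · refine Or.inr ⟨fun hx => ?_, l', Or.inr hl'⟩
            rw [hx, ← hi] at hl'
            exact (hc.column y).not_dead_live hl'
        · rw [hqo l' c] at hl'
          refine Or.inr ⟨fun hx => c ?_, l', hl'⟩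
          rw [hx] at hl'
          exact (hc.column y).level_unique hl' (Or.inl hi)
      · rintro (hx | ⟨hx, l', hl'⟩)
        · exact ⟨l, Or.inl (by omega)⟩
        · rcases hl' with hl' | hl'
          · have c : l' ≠ l := by rintro rfl; omega
            exact ⟨l', Or.inl (by rw [hqo l' c, hl'])⟩
          · exact ⟨l', Or.inr hl'⟩
    · simp [hy, hqx y hy]
  · have h1 := h.rank i j l (Or.inl hi)
    have h2 := h'.rank ⟨a, by omega⟩ j l (Or.inl hql)
    simp only at h2
    omega
  · rintro ⟨x, y⟩ hx hne
    obtain ⟨l', hl'⟩ := (h'.mem_D x y).1 hx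
    have h2 := h'.rank x y l' hl'
    have h1 := h.rank x y l' (by
      by_cases hy : y = j
      · subst hy
        by_cases c : l' = l
        · subst c
          refine Or.inr (hl'.resolve_left fun he => hne ?_)
          rw [Prod.mk.injEq]
          exact ⟨Fin.ext (by simp only; omega), rfl⟩
        · rwa [hqo l' c] at hl'
      · rwa [hqx y hy] at hl')
    omega
  · ext ⟨x, y⟩
    rw [h.mem_F, h'.mem_F]

theorem Represents.kBubblingMove (h : Represents 𝒟 q F) (hc : IsConfig p n q F)
    (h' : Represents 𝒟' q' F') (hc' : IsConfig p n q' F') {j : Fin k} {l a : ℕ} {i : Fin n}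
    (hi : q j l = i) (ha : a + 1 = i) (hq : q' = Function.update q j (Function.update (q j) l a))
    (hF : F' = Function.update F j fun l' r => F j l' r ∨ (l' = l ∧ r = i)) :
    KBubblingMove 𝒟 i j 𝒟' := by
  have hin := i.2
  have hqj : q' j = Function.update (q j) l a := by rw [hq, Function.update_self]
  have hql : q' j l = a := by rw [hqj, Function.update_self]
  have hqo : ∀ l', l' ≠ l → q' j l' = q j l' := fun l' hl' => by
    rw [hqj, Function.update_of_ne hl']
  have hqx : ∀ x, x ≠ j → q' x = q x := fun x hx => by rw [hq, Function.update_of_ne hx]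
  have hFj : ∀ l' r, F' j l' r ↔ F j l' r ∨ (l' = l ∧ r = i) := fun l' r => by
    rw [hF, Function.update_self]
  have hFx : ∀ x, x ≠ j → F' x = F x := fun x hx => by rw [hF, Function.update_of_ne hx]
  have hFl : F' j l i := (hFj l i).2 (Or.inr ⟨rfl, rfl⟩)
  have hcol := hc'.column j
  have hfree : ¬ Occupied (q j) (F j) a := by
    rw [hqj] at hcol
    exact not_occupied_of_update (by omega) hcol fun l' r hl' => (hFj l' r).2 (Or.inl hl')
  refine ⟨(h.mem_live hc i j).2 ⟨l, hi⟩, ?_, ⟨a, by omega⟩, ha, ?_, ?_, ?_, ?_, ?_⟩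
  · intro x hx he
    obtain ⟨l', hl'⟩ := (h.mem_F i x).1 hx
    have h1 := h.rank i j l (Or.inl hi)
    have h2 := h.rank i x l' (Or.inr hl')
    obtain rfl : l' = l := by omega
    by_cases c : x = j
    · subst c
      rw [← hi] at hl'
      exact (hc.column x).not_dead_live hl'
    · refine c (hc'.uniq _ _ l' i ?_ hFl)
      rw [hFx x c]
      exact hl'
  · rw [h.mem_D]
    exact hfree
  · ext ⟨x, y⟩
    rw [Finset.mem_insert, h.mem_D, h'.mem_D]
    by_cases hy : y = j
    · subst hy
      simp only [Prod.mk.injEq, and_true, Fin.ext_iff]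
      constructor
      · rintro ⟨l', hl' | hl'⟩
        · by_cases c : l' = l
          · subst c
            exact Or.inl (by omega)
          · rw [hqo l' c] at hl'
            exact Or.inr ⟨l', Or.inl hl'⟩
        · rcases (hFj _ _).1 hl' with hl' | ⟨rfl, hx⟩
          · exact Or.inr ⟨l', Or.inr hl'⟩
          · exact Or.inr ⟨l', Or.inl (by omega)⟩
      · rintro (hx | ⟨l', hl' | hl'⟩)
        · exact ⟨l, Or.inl (by omega)⟩
        · by_cases c : l' = l
          · subst c
            exact ⟨l', Or.inr ((hFj _ _).2 (Or.inr ⟨rfl, by omega⟩))⟩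
          · exact ⟨l', Or.inl (by rw [hqo l' c, hl'])⟩
        · exact ⟨l', Or.inr ((hFj _ _).2 (Or.inl hl'))⟩
    · simp [hy, hqx y hy, hFx y hy]
  · have h1 := h.rank i j l (Or.inl hi)
    have h2 := h'.rank ⟨a, by omega⟩ j l (Or.inl hql)
    simp only at h2
    omega
  · rintro ⟨x, y⟩ hx hne
    obtain ⟨l', hl'⟩ := (h'.mem_D x y).1 hx
    have h2 := h'.rank x y l' hl'
    have h1 := h.rank x y l' (by
      by_cases hy : y = j
      · subst hy
        rw [hFj] at hl'
        by_cases c : l' = l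
        · subst c
          rcases hl' with hl' | hl' | hl'
          · refine absurd ?_ hne
            rw [Prod.mk.injEq]
            exact ⟨Fin.ext (by simp only; omega), rfl⟩
          · exact Or.inr hl'
          · exact Or.inl (by omega)
        · rw [hqo l' c] at hl'
          tauto
      · rwa [hqx y hy, hFx y hy] at hl')
    omega
  · ext ⟨x, y⟩
    rw [Finset.mem_insert, h.mem_F, h'.mem_F]
    by_cases hy : y = j
    · subst hy
      simp only [hFj, Prod.mk.injEq, and_true, Fin.ext_iff]
      constructor
      · rintro ⟨l', hl' | hl'⟩
        · exact Or.inr ⟨l', hl'⟩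
        · exact Or.inl hl'.2
      · rintro (hx | ⟨l', hl'⟩)
        · exact ⟨l, Or.inr ⟨rfl, hx⟩⟩
        · exact ⟨l', Or.inl hl'⟩
    · simp [hy, hFx y hy]

/-- A move is determined by its square, so the diagram of the updated configuration must be `𝒟'`. -/
theorem Represents.of_bubblingMove (h : Represents 𝒟 q F) (hc : IsConfig p n q F) {i : Fin n}
    {j : Fin k} (hm : BubblingMove 𝒟 i j 𝒟') :
    ∃ l a : ℕ, q j l = i ∧ a + 1 = i ∧
      IsConfig p n (Function.update q j (Function.update (q j) l a)) F ∧
      Represents 𝒟' (Function.update q j (Function.update (q j) l a)) F := by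
  obtain ⟨hlive, a, ha, hfree, -⟩ := id hm
  obtain ⟨l, hl⟩ := (h.mem_live hc i j).1 hlive
  rw [h.mem_D] at hfree
  have hc' : IsConfig p n (Function.update q j (Function.update (q j) l (a : ℕ))) F := by
    have := hc.update_one ((hc.column j).moveUp (G := F j) (l := l) (a := (a : ℕ)) (by omega)
      (by have := i.2; omega) hfree fun l' r hr => Or.inl hr)
      (fun l' r hr x hx hx' => hx (hc.uniq _ _ _ _ hx' hr))
    rwa [Function.update_eq_self] at this
  obtain ⟨𝒟₁, h₁⟩ := exists_represents hc'
  obtain rfl := hm.unique (h.bubblingMove hc h₁ hc' hl ha rfl)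
  exact ⟨l, a, hl, ha, hc', h₁⟩

theorem Represents.of_kBubblingMove (h : Represents 𝒟 q F) (hc : IsConfig p n q F) {i : Fin n}
    {j : Fin k} (hm : KBubblingMove 𝒟 i j 𝒟') :
    ∃ l a : ℕ, q j l = i ∧ a + 1 = i ∧
      IsConfig p n (Function.update q j (Function.update (q j) l a))
        (Function.update F j fun l' r => F j l' r ∨ (l' = l ∧ r = i)) ∧
      Represents 𝒟' (Function.update q j (Function.update (q j) l a))
        (Function.update F j fun l' r => F j l' r ∨ (l' = l ∧ r = i)) := by
  obtain ⟨hlive, hrank, a, ha, hfree, -⟩ := id hm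
  obtain ⟨l, hl⟩ := (h.mem_live hc i j).1 hlive
  rw [h.mem_D] at hfree
  have hc' : IsConfig p n (Function.update q j (Function.update (q j) l (a : ℕ)))
      (Function.update F j fun l' r => F j l' r ∨ (l' = l ∧ r = i)) := by
    refine hc.update_one ((hc.column j).moveUp (l := l) (a := (a : ℕ)) (by omega)
      (by have := i.2; omega) hfree fun l' r hr => by rwa [hl]) ?_
    rintro l' r (hr | ⟨rfl, rfl⟩) x hx hx'
    · exact hx (hc.uniq _ _ _ _ hx' hr)
    · refine hrank x ((h.mem_F i x).2 ⟨l', hx'⟩) ?_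
      have h1 := h.rank i j l' (Or.inl hl)
      have h2 := h.rank i x l' (Or.inr hx')
      omega
  obtain ⟨𝒟₁, h₁⟩ := exists_represents hc'
  obtain rfl := hm.unique (h.kBubblingMove hc h₁ hc' hl ha rfl rfl)
  exact ⟨l, a, hl, ha, hc', h₁⟩

/-- Every diagram obtained by moves is represented by a configuration. -/
theorem Represents.exists_of_mem_BD (h : Represents 𝒟 q F) (hc : IsConfig p n q F)
    (hm : 𝒟' ∈ BD 𝒟) : ∃ q' F', IsConfig p n q' F' ∧ Represents 𝒟' q' F' := by
  change Relation.ReflTransGen Move 𝒟 𝒟' at hm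
  induction hm with
  | refl => exact ⟨q, F, hc, h⟩
  | tail _ hm ih =>
    obtain ⟨q₁, F₁, hc₁, h₁⟩ := ih
    obtain ⟨i, j, hm | hm⟩ := hm
    · obtain ⟨l, a, -, -, h2, h3⟩ := h₁.of_bubblingMove hc₁ hm
      exact ⟨_, _, h2, h3⟩
    · obtain ⟨l, a, -, -, h2, h3⟩ := h₁.of_kBubblingMove hc₁ hm
      exact ⟨_, _, h2, h3⟩

/-- Every configuration is obtained by moves from the initial one. -/
theorem exists_mem_BD_represents (h : Represents 𝒟 p fun _ _ _ => False)
    (hp : ∀ j, StrictMono (p j)) (hc : IsConfig p n q F) : ∃ 𝒟' ∈ BD 𝒟, Represents 𝒟' q F := by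
  classical
  -- The total displacement. Levels from `n` on start at or below row `n` and never move.
  obtain ⟨N, hN⟩ : ∃ N, N = ∑ j, ∑ l ∈ Finset.range n, (p j l - q j l) := ⟨_, rfl⟩
  induction N using Nat.strong_induction_on generalizing q F with
  | _ N ih =>
  by_cases hall : ∀ j l, q j l = p j l
  · have hq : q = p := by funext j l; exact hall j l
    have hF : F = fun _ _ _ => False := by
      funext j l i
      refine eq_false fun hi => ?_
      have := (hc.column j).dead _ _ hi
      have := hall j l
      omega
    subst hq hF
    exact ⟨𝒟, Relation.ReflTransGen.refl, h⟩
  push Not at hall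
  obtain ⟨j, l₀, hl₀⟩ := hall
  have hcol := hc.column j
  -- The lower end of a run of displaced squares; it exists since a sentinel is never displaced.
  -- This live square can be moved back down by one row, because the next one is at its initial row.
  obtain ⟨l, hl, hl'⟩ : ∃ l, q j l < p j l ∧ q j (l + 1) = p j (l + 1) := by
    by_contra! hcon
    have key : ∀ d, q j (l₀ + d) < p j (l₀ + d) := fun d => by
      induction d with
      | zero => exact lt_of_le_of_ne (hcol.le _) hl₀
      | succ d ihd => exact lt_of_le_of_ne (hcol.le _) (hcon _ ihd)
    have h1 := key n
    have h2 := (hp j).le_apply (x := l₀ + n)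
    have h3 := hcol.fix (l₀ + n) (by omega)
    omega
  have hpn : p j l < n := by
    by_contra hcon
    have := hcol.fix l (by omega)
    omega
  set q₀ : Fin k → ℕ → ℕ := Function.update q j (Function.update (q j) l (q j l + 1)) with hq₀
  set F₀ : Fin k → ℕ → ℕ → Prop :=
    Function.update F j fun l' r => F j l' r ∧ ¬ (l' = l ∧ r = q j l + 1) with hF₀
  have hpl := hp j (Nat.lt_succ_self l)
  have hc₀ : IsConfig p n q₀ F₀ := by
    refine hc.update_one ⟨fun l' => ?_, fun l' => ?_, fun l' hl' => ?_, fun l' i hi => ?_⟩ ?_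
    · have h1 := hcol.lt_succ l'
      by_cases c : l' = l
      · subst c
        rw [Function.update_self, Function.update_of_ne (by omega)]
        simp only [Nat.succ_eq_add_one] at hpl
        omega
      · rw [Function.update_of_ne c]
        by_cases c' : l' + 1 = l
        · subst c'
          rw [Function.update_self]
          omega
        · rw [Function.update_of_ne c']
          exact h1
    · by_cases c : l' = l
      · subst c
        rw [Function.update_self]
        exact hl
      · rw [Function.update_of_ne c]
        exact hcol.le l'
    · have c : l' ≠ l := by rintro rfl; omega
      rw [Function.update_of_ne c]
      exact hcol.fix l' hl'
    · obtain ⟨hF, hne⟩ := hi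
      have hd := hcol.dead _ _ hF
      by_cases c : l' = l
      · subst c
        rw [Function.update_self, Function.update_of_ne (by omega)]
        simp only [true_and] at hne
        omega
      · rw [Function.update_of_ne c]
        by_cases c' : l' + 1 = l
        · subst c'
          rw [Function.update_self]
          omega
        · rw [Function.update_of_ne c']
          exact hd
    · rintro l' i ⟨hF, -⟩ x hx hx'
      exact hx (hc.uniq _ _ _ _ hx' hF)
  have hsum : ∑ j, ∑ l ∈ Finset.range n, (p j l - q₀ j l) <
      ∑ j, ∑ l ∈ Finset.range n, (p j l - q j l) := by
    have hle : ∀ j' l', q j' l' ≤ q₀ j' l' := fun j' l' => by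
      by_cases c : j' = j
      · subst c
        rw [hq₀, Function.update_self]
        by_cases c' : l' = l
        · subst c'
          rw [Function.update_self]
          omega
        · rw [Function.update_of_ne c']
      · rw [hq₀, Function.update_of_ne c]
    refine Finset.sum_lt_sum (fun j' _ => Finset.sum_le_sum fun l' _ => ?_)
      ⟨j, Finset.mem_univ j, Finset.sum_lt_sum (fun l' _ => ?_) ⟨l, ?_, ?_⟩⟩
    · have := hle j' l'
      omega
    · have := hle j l'
      omega
    · have := hcol.self_le l
      simp only [Finset.mem_range]
      omega
    · rw [hq₀, Function.update_self, Function.update_self]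
      omega
  obtain ⟨𝒟₀, hm₀, h₀⟩ := ih _ (by omega) hc₀ rfl
  obtain ⟨𝒟₁, h₁⟩ := exists_represents hc
  refine ⟨𝒟₁, Relation.ReflTransGen.tail hm₀ ⟨⟨q j l + 1, by omega⟩, j, ?_⟩, h₁⟩
  have hq : q = Function.update q₀ j (Function.update (q₀ j) l (q j l)) := by
    rw [hq₀]
    simp
  have hi : q₀ j l = q j l + 1 := by rw [hq₀]; simp
  -- The row just below the live square decides which kind of move came last: K-bubbling if it is
  -- dead, bubbling if not.
  by_cases hF : F j l (q j l + 1)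
  · right
    refine h₀.kBubblingMove hc₀ h₁ hc (l := l) hi rfl hq ?_
    funext x
    by_cases c : x = j
    · subst c
      rw [hF₀, Function.update_self, Function.update_self]
      funext l' r
      simp only [eq_iff_iff]
      constructor
      · tauto
      · rintro (h1 | ⟨rfl, rfl⟩)
        · exact h1.1
        · exact hF
    · rw [hF₀, Function.update_of_ne c, Function.update_of_ne c]
  · left
    have hFF : F₀ = F := by
      funext x
      by_cases c : x = j
      · subst c
        rw [hF₀, Function.update_self]
        funext l' r
        simp only [eq_iff_iff, and_iff_left_iff_imp]
        rintro h1 ⟨rfl, rfl⟩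
        exact hF h1
      · rw [hF₀, Function.update_of_ne c]
    rw [hFF] at h₀ hc₀
    exact h₀.bubblingMove hc₀ h₁ hc (l := l) hi rfl hq

theorem Represents.wt_apply (h : Represents 𝒟 q F) (i : Fin n) :
    𝒟.wt i = occupiedCount q F i := by
  classical
  simp only [wt, Finsupp.equivFunOnFinite_symm_apply_apply]
  unfold occupiedCount
  refine Finset.card_bij (fun x _ => x.2) ?_ ?_ ?_
  · rintro ⟨a, b⟩ hx
    simp only [Finset.mem_filter, Finset.mem_univ, true_and, h.mem_D] at hx ⊢
    obtain ⟨hx, rfl⟩ := hx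
    exact hx
  · rintro ⟨a, b⟩ hx ⟨a', b'⟩ hx' hb
    simp only [Finset.mem_filter] at hx hx'
    exact Prod.ext (hx.2.trans hx'.2.symm) hb
  · intro b hb
    simp only [Finset.mem_filter, Finset.mem_univ, true_and] at hb
    exact ⟨(i, b), by simpa [h.mem_D] using hb, rfl⟩

theorem Represents.heightIndex_live (h : Represents 𝒟 q F) (hc : IsConfig p n q F) {i : Fin n}
    {j : Fin k} {l : ℕ} (hl : q j l = i) : heightIndex 𝒟.live (i, j) = l + 1 := by
  have hin := i.2
  have s := (hc.column j).strictMono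
  rw [← Finset.card_range (l + 1), heightIndex]
  symm
  refine Finset.card_bij (fun a ha => (⟨q j a, ?_⟩, j)) ?_ ?_ ?_
  · have := s.monotone (show a ≤ l by simp only [Finset.mem_range] at ha; omega)
    omega
  · intro a ha
    simp only [Finset.mem_filter, h.mem_live hc]
    refine ⟨⟨a, rfl⟩, trivial, ?_⟩
    rw [Fin.le_def]
    have := s.monotone (show a ≤ l by simp only [Finset.mem_range] at ha; omega)
    simp only
    omega
  · intro a _ b _ hab
    simp only [Prod.mk.injEq, Fin.mk.injEq, and_true] at hab
    exact s.injective hab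
  · rintro ⟨x, y⟩ hx
    simp only [Finset.mem_filter, h.mem_live hc] at hx
    obtain ⟨hx1, rfl, hx3⟩ := hx
    obtain ⟨a, ha⟩ := hx1
    rw [Fin.le_def] at hx3
    have := s.le_iff_le.1 (show q y a ≤ q y l by omega)
    refine ⟨a, by simp only [Finset.mem_range]; omega, ?_⟩
    simp [ha]

end BubblingDiagram

/-! ### Termination and uniqueness of the top diagram -/

/-- The family `I` records an invariant of the diagram together with the value `N` of a decreasing
measure. -/
theorem exists_reflTransGen_normal {α : Type*} {R : α → α → Prop} {I : ℕ → α → Prop}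
    (h : ∀ N a b, I N a → R a b → ∃ N' < N, I N' b) {N : ℕ} {a : α} (ha : I N a) :
    ∃ b, Relation.ReflTransGen R a b ∧ ∀ c, ¬ R b c := by
  induction N using Nat.strong_induction_on generalizing a with
  | _ N ih =>
    by_cases hR : ∃ b, R a b
    · obtain ⟨b, hb⟩ := hR
      obtain ⟨N', hN', hI⟩ := h N a b ha hb
      obtain ⟨c, hc, hc'⟩ := ih N' hN' hI
      exact ⟨c, Relation.ReflTransGen.head hb hc, hc'⟩
    · push Not at hR
      exact ⟨a, Relation.ReflTransGen.refl, hR⟩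

theorem exists_of_reflTransGen {α : Type*} {R : α → α → Prop} {I : ℕ → α → Prop}
    (h : ∀ N a b, I N a → R a b → ∃ N' < N, I N' b) {N : ℕ} {a b : α} (ha : I N a)
    (hab : Relation.ReflTransGen R a b) : ∃ N', I N' b := by
  induction hab with
  | refl => exact ⟨N, ha⟩
  | tail _ hbc ih =>
    obtain ⟨N', hN'⟩ := ih
    obtain ⟨N'', -, h''⟩ := h _ _ _ hN' hbc
    exact ⟨N'', h''⟩

theorem sum_update_lt {n k : ℕ} {q : Fin k → ℕ → ℕ} {j : Fin k} {l a : ℕ} (hl : l < n)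
    (ha : a < q j l) :
    ∑ y, ∑ x ∈ Finset.range n, Function.update q j (Function.update (q j) l a) y x <
      ∑ y, ∑ x ∈ Finset.range n, q y x := by
  have hle : ∀ y x, Function.update q j (Function.update (q j) l a) y x ≤ q y x := fun y x => by
    by_cases c : y = j
    · subst c
      rw [Function.update_self]
      by_cases c' : x = l
      · subst c'
        rw [Function.update_self]
        exact ha.le
      · rw [Function.update_of_ne c']
    · rw [Function.update_of_ne c]
  refine Finset.sum_lt_sum (fun y _ => Finset.sum_le_sum fun x _ => hle y x)
    ⟨j, Finset.mem_univ j, Finset.sum_lt_sum (fun x _ => hle j x) ⟨l, Finset.mem_range.2 hl, ?_⟩⟩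
  rw [Function.update_self, Function.update_self]
  exact ha

section Top

open BubblingDiagram

variable {n : ℕ} {w : Equiv.Perm (Fin n)} {q : Fin n → ℕ → ℕ} {F : Fin n → ℕ → ℕ → Prop}
  {𝒟 𝒟' : BubblingDiagram n n}

theorem isConfig_levelRow (w : Equiv.Perm (Fin n)) :
    IsConfig (levelRow w) n (levelRow w) fun _ _ _ => False :=
  ⟨fun j => ⟨fun l => levelRow_strictMono w j (Nat.lt_succ_self l), fun _ => le_rfl,
    fun _ _ => rfl, fun _ _ h => h.elim⟩, fun _ _ _ _ h => h.elim⟩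

theorem represents_rotheBubblingDiagram (w : Equiv.Perm (Fin n)) :
    (rotheBubblingDiagram w).Represents (levelRow w) fun _ _ _ => False := by
  refine ⟨fun i j => ?_, fun i j => ?_, fun i j l hl => ?_⟩
  · constructor
    · intro hij
      exact ⟨_, Or.inl (levelRow_level hij)⟩
    · rintro ⟨l, hl | hl⟩
      · have hlt : levelRow w j l < n := by rw [hl]; exact i.2
        have := levelRow_mem hlt
        rwa [show (⟨levelRow w j l, hlt⟩ : Fin n) = i from Fin.ext hl] at this
      · exact hl.elim
  · simp [rotheBubblingDiagram]
  · have hl := hl.resolve_right id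
    have hlt : levelRow w j l < n := by rw [hl]; exact i.2
    have hmem := levelRow_mem hlt
    have hlev := level_levelRow hlt
    rw [show (⟨levelRow w j l, hlt⟩ : Fin n) = i from Fin.ext hl] at hmem hlev
    have h1 := rotheRank_add_level hmem
    rw [hlev] at h1
    simpa [rotheBubblingDiagram, hmem] using h1

theorem isDistinguished_iff (h : 𝒟.Represents q F) (hc : IsConfig (levelRow w) n q F) {i : Fin n}
    {j : Fin n} : IsDistinguished w 𝒟 (i, j) ↔ ∃ m, (j, m) ∈ distinguishedLevels w ∧ q j m = i := by
  have hidx : ∀ a ∈ distinguishedSquares w, heightIndex (rotheDiagram w) a = level w a + 1 := by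
    rintro ⟨a, b⟩ ha
    have h1 := (represents_rotheBubblingDiagram w).heightIndex_live (isConfig_levelRow w)
      (levelRow_level (mem_rotheDiagram_of_mem_distinguishedSquares ha))
    simpa [BubblingDiagram.live, rotheBubblingDiagram] using h1
  rw [IsDistinguished, h.mem_live hc]
  constructor
  · rintro ⟨⟨l, hl⟩, a, ha, rfl, hidx'⟩
    rw [h.heightIndex_live hc hl, hidx a ha] at hidx'
    obtain rfl : l = level w a := by omega
    exact ⟨_, List.mem_map.2 ⟨a, ha, rfl⟩, hl⟩
  · rintro ⟨m, hm, hmi⟩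
    refine ⟨⟨m, hmi⟩, ?_⟩
    obtain ⟨hn, ha⟩ := mem_distinguishedLevels.1 hm
    exact ⟨_, ha, rfl, by rw [h.heightIndex_live hc hmi, hidx _ ha, level_levelRow hn]⟩

/-- The diagrams in the first phase of the construction of `𝒟^⊤(w)`. -/
def FirstPhase (w : Equiv.Perm (Fin n)) (N : ℕ) (𝒟 : BubblingDiagram n n) : Prop :=
  ∃ q, IsConfig (levelRow w) n q (fun _ _ _ => False) ∧ 𝒟.Represents q (fun _ _ _ => False) ∧
    (∀ j l, q j l ≠ levelRow w j l → ∃ m, l < m ∧ (j, m) ∈ distinguishedLevels w) ∧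
    N = ∑ j, ∑ l ∈ Finset.range n, q j l

theorem FirstPhase.step {N : ℕ} (h : FirstPhase w N 𝒟) (hs : TopBubblingStep w 𝒟 𝒟') :
    ∃ N' < N, FirstPhase w N' 𝒟' := by
  obtain ⟨q, hc, hr, hq, rfl⟩ := h
  obtain ⟨i, j, ⟨i₀, hi₀, hd⟩, hm⟩ := hs
  obtain ⟨m, hmA, hmi⟩ := (isDistinguished_iff hr hc).1 hd
  obtain ⟨l, a, hl, ha, hc', hr'⟩ := hr.of_bubblingMove hc hm
  have hln : l < n := by
    have := (hc.column j).self_le l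
    have := i.2
    omega
  refine ⟨_, sum_update_lt hln (show a < q j l by omega), _, hc', hr', fun y x hyx => ?_, rfl⟩
  by_cases c : y = j
  · subst c
    by_cases c' : x = l
    · subst c'
      refine ⟨m, (hc.column y).strictMono.lt_iff_lt.1 ?_, hmA⟩
      rw [hl, hmi]
      exact hi₀
    · rw [Function.update_self, Function.update_of_ne c'] at hyx
      exact hq y x hyx
  · rw [Function.update_of_ne c] at hyx
    exact hq y x hyx

/-- The diagrams in the second phase of the construction of `𝒟^⊤(w)`. -/
def SecondPhase (w : Equiv.Perm (Fin n)) (N : ℕ) (𝒟 : BubblingDiagram n n) : Prop :=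
  ∃ q F, IsConfig (levelRow w) n q F ∧ 𝒟.Represents q F ∧
    (∀ j m l, (j, m) ∈ distinguishedLevels w → l < m → q j l = l) ∧
    (∀ j l, q j l ≠ levelRow w j l → ∃ m, l ≤ m ∧ (j, m) ∈ distinguishedLevels w) ∧
    (∀ j l i, F j l i ↔ (j, l) ∈ distinguishedLevels w ∧ q j l < i ∧ i ≤ levelRow w j l) ∧
    N = ∑ j, ∑ l ∈ Finset.range n, q j l

theorem FirstPhase.secondPhase {N : ℕ} (h : FirstPhase w N 𝒟)
    (hs : ∀ 𝒟', ¬ TopBubblingStep w 𝒟 𝒟') : SecondPhase w N 𝒟 := by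
  classical
  obtain ⟨q, hc, hr, hq, rfl⟩ := h
  refine ⟨q, _, hc, hr, fun j m l hm => ?_, fun j l hjl => ?_, fun j l i => ?_, rfl⟩
  -- If the live squares before `l` are packed in the top rows and square `l` is lower than row `l`,
  -- then the row above it is free and a bubbling move is still possible.
  · induction l using Nat.strong_induction_on with
    | _ l ih =>
    intro hlm
    by_contra hne
    have hcol := hc.column j
    have hlt : l < q j l := lt_of_le_of_ne (hcol.self_le l) (Ne.symm hne)
    have hmn := (mem_distinguishedLevels.1 hm).1
    have h1 := hcol.le m
    have h2 := hcol.strictMono hlm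
    have hfree : ¬ Occupied (q j) (fun _ _ => False) (q j l - 1) := by
      rintro ⟨l', hl' | hl'⟩
      · have h3 := hcol.strictMono.lt_iff_lt.1 (show q j l' < q j l by omega)
        have h4 := ih l' h3 (h3.trans hlm)
        omega
      · exact hl'
    have hc' : IsConfig (levelRow w) n
        (Function.update q j (Function.update (q j) l (q j l - 1))) (fun _ _ _ => False) := by
      have := hc.update_one (hcol.moveUp (G := fun _ _ => False) (l := l) (a := q j l - 1)
        (by omega) (by omega) hfree fun _ _ h => h.elim) (fun _ _ h => h.elim)
      rwa [Function.update_eq_self] at this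
    obtain ⟨𝒟', hr'⟩ := exists_represents hc'
    refine hs 𝒟' ⟨⟨q j l, by omega⟩, j, ⟨⟨q j m, by omega⟩, h2, ?_⟩,
      hr.bubblingMove hc hr' hc' (l := l) (a := q j l - 1) rfl (by simp only; omega) rfl⟩
    exact (isDistinguished_iff hr hc).2 ⟨m, hm, rfl⟩
  · obtain ⟨m, hlm, hm⟩ := hq j l hjl
    exact ⟨m, hlm.le, hm⟩
  -- There are no dead squares yet: only squares strictly above the one distinguished square of a
  -- column have moved, so that square is still in its initial row and the interval of dead rows is
  -- empty.
  · rw [false_iff]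
    rintro ⟨hA, h1, h2⟩
    obtain ⟨m, hlm, hm⟩ := hq j l (by omega)
    have := level_unique_of_mem_distinguishedLevels hA hm
    omega

theorem SecondPhase.step {N : ℕ} (h : SecondPhase w N 𝒟) (hs : TopKBubblingStep w 𝒟 𝒟') :
    ∃ N' < N, SecondPhase w N' 𝒟' := by
  obtain ⟨q, F, hc, hr, ht, hq, hF, rfl⟩ := h
  obtain ⟨i, j, hd, hm⟩ := hs
  obtain ⟨m, hmA, hmi⟩ := (isDistinguished_iff hr hc).1 hd
  obtain ⟨l, a, hl, ha, hc', hr'⟩ := hr.of_kBubblingMove hc hm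
  obtain rfl : l = m := (hc.column j).strictMono.injective (hl.trans hmi.symm)
  have hln : l < n := by
    have := (hc.column j).self_le l
    have := i.2
    omega
  refine ⟨_, sum_update_lt hln (show a < q j l by omega), _, _, hc', hr', fun y m x hym hx => ?_,
    fun y x hyx => ?_, fun y x r => ?_, rfl⟩
  · by_cases c : y = j
    · subst c
      obtain rfl := level_unique_of_mem_distinguishedLevels hym hmA
      rw [Function.update_self, Function.update_of_ne hx.ne]
      exact ht y m x hym hx
    · rw [Function.update_of_ne c]
      exact ht y m x hym hx
  · by_cases c : y = j
    · subst c
      by_cases c' : x = l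
      · subst c'
        exact ⟨x, le_rfl, hmA⟩
      · rw [Function.update_self, Function.update_of_ne c'] at hyx
        exact hq y x hyx
    · rw [Function.update_of_ne c] at hyx
      exact hq y x hyx
  · by_cases c : y = j
    · subst c
      rw [Function.update_self, Function.update_self, hF]
      by_cases c' : x = l
      · subst c'
        rw [Function.update_self]
        have := (hc.column y).le x
        constructor
        · rintro (⟨-, h1, h2⟩ | ⟨-, rfl⟩)
          · exact ⟨hmA, by omega, h2⟩
          · exact ⟨hmA, by omega, by omega⟩
        · rintro ⟨-, h1, h2⟩
          by_cases h3 : r = i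
          · exact Or.inr ⟨rfl, h3⟩
          · exact Or.inl ⟨hmA, by omega, h2⟩
      · rw [Function.update_of_ne c']
        simp [c']
    · rw [Function.update_of_ne c, Function.update_of_ne c]
      exact hF y x r

open Classical in
/-- The rows of the live squares of `𝒟^⊤(w)`. -/
noncomputable def topRow (w : Equiv.Perm (Fin n)) (j : Fin n) (l : ℕ) : ℕ :=
  if ∃ m, l ≤ m ∧ (j, m) ∈ distinguishedLevels w then l else levelRow w j l

/-- The rows of the dead squares of `𝒟^⊤(w)`. -/
def TopDead (w : Equiv.Perm (Fin n)) (j : Fin n) (l i : ℕ) : Prop :=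
  (j, l) ∈ distinguishedLevels w ∧ l < i ∧ i ≤ levelRow w j l

/-- Nothing stops a distinguished live square of level `m` before row `m`: the rows from `m` on
above it are free, and the rank condition holds because distinguished squares in different columns
have different levels. So the final positions are forced. -/
theorem SecondPhase.represents_top {N : ℕ} (h : SecondPhase w N 𝒟)
    (hs : ∀ 𝒟', ¬ TopKBubblingStep w 𝒟 𝒟') : 𝒟.Represents (topRow w) (TopDead w) := by
  obtain ⟨q, F, hc, hr, ht, hq, hF, rfl⟩ := h
  have key : ∀ j m, (j, m) ∈ distinguishedLevels w → q j m = m := by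
    intro j m hm
    by_contra hne
    have hcol := hc.column j
    have hlt : m < q j m := lt_of_le_of_ne (hcol.self_le m) (Ne.symm hne)
    have hmn := (mem_distinguishedLevels.1 hm).1
    have h1 := hcol.le m
    have hfree : ¬ Occupied (q j) (F j) (q j m - 1) := by
      rintro ⟨l', hl' | hl'⟩
      · have h3 := hcol.strictMono.lt_iff_lt.1 (show q j l' < q j m by omega)
        have h4 := ht j m l' hm h3
        omega
      · have h3 := (hF _ _ _).1 hl'
        obtain rfl := level_unique_of_mem_distinguishedLevels hm h3.1
        omega
    have hc' : IsConfig (levelRow w) n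
        (Function.update q j (Function.update (q j) m (q j m - 1)))
        (Function.update F j fun l' r => F j l' r ∨ (l' = m ∧ r = q j m)) := by
      refine hc.update_one (hcol.moveUp (l := m) (a := q j m - 1)
        (by omega) (by omega) hfree fun _ _ h => h) ?_
      rintro l' r (h2 | ⟨rfl, rfl⟩) x hx hx'
      · exact hx (hc.uniq _ _ _ _ hx' h2)
      · exact hx (column_unique_of_mem_distinguishedLevels ((hF _ _ _).1 hx').1 hm)
    obtain ⟨𝒟', hr'⟩ := exists_represents hc'
    refine hs 𝒟' ⟨⟨q j m, by omega⟩, j, (isDistinguished_iff hr hc).2 ⟨m, hm, rfl⟩,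
      hr.kBubblingMove hc hr' hc' (l := m) (a := q j m - 1) rfl (by simp only; omega) rfl rfl⟩
  have hqt : q = topRow w := by
    funext j l
    rw [topRow]
    split_ifs with hex
    · obtain ⟨m, hlm, hm⟩ := hex
      rcases hlm.eq_or_lt with rfl | hlm
      · exact key j l hm
      · exact ht j m l hm hlm
    · by_contra hne
      exact hex (hq j l hne)
  have hFt : F = TopDead w := by
    funext j l i
    rw [eq_iff_iff, hF, TopDead]
    constructor
    · rintro ⟨h1, h2, h3⟩
      rw [key j l h1] at h2
      exact ⟨h1, h2, h3⟩
    · rintro ⟨h1, h2, h3⟩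
      rw [key j l h1]
      exact ⟨h1, h2, h3⟩
  rw [← hqt, ← hFt]
  exact hr

theorem firstPhase_rotheBubblingDiagram (w : Equiv.Perm (Fin n)) :
    ∃ N, FirstPhase w N (rotheBubblingDiagram w) :=
  ⟨_, _, isConfig_levelRow w, represents_rotheBubblingDiagram w, fun _ _ h => absurd rfl h, rfl⟩

theorem IsTopDiagram.represents {𝒯 : BubblingDiagram n n} (h : IsTopDiagram w 𝒯) :
    𝒯.Represents (topRow w) (TopDead w) := by
  obtain ⟨ℰ, h1, h2, h3, h4⟩ := h
  obtain ⟨N, hN⟩ := firstPhase_rotheBubblingDiagram w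
  obtain ⟨N₁, hN₁⟩ := exists_of_reflTransGen (R := TopBubblingStep w) (I := FirstPhase w)
    (fun _ _ _ => FirstPhase.step) hN h1
  obtain ⟨N₂, hN₂⟩ := exists_of_reflTransGen (R := TopKBubblingStep w) (I := SecondPhase w)
    (fun _ _ _ => SecondPhase.step)
    (hN₁.secondPhase h2) h3
  exact hN₂.represents_top h4

theorem exists_isTopDiagram (w : Equiv.Perm (Fin n)) : ∃ 𝒯, IsTopDiagram w 𝒯 := by
  obtain ⟨N, hN⟩ := firstPhase_rotheBubblingDiagram w
  obtain ⟨ℰ, h1, h2⟩ := exists_reflTransGen_normal (R := TopBubblingStep w) (I := FirstPhase w)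
    (fun _ _ _ => FirstPhase.step) hN
  obtain ⟨N₁, hN₁⟩ := exists_of_reflTransGen (R := TopBubblingStep w) (I := FirstPhase w)
    (fun _ _ _ => FirstPhase.step) hN h1
  obtain ⟨𝒯, h3, h4⟩ := exists_reflTransGen_normal (R := TopKBubblingStep w) (I := SecondPhase w)
    (fun _ _ _ => SecondPhase.step)
    (hN₁.secondPhase h2)
  exact ⟨𝒯, ℰ, h1, h2, h3, h4⟩

end Top

/-! ### The theorem -/

theorem theorem3 {n : ℕ} (w : Equiv.Perm (Fin n)) (hw : Vexillary w) :
    (∃! 𝒯 : BubblingDiagram n n, IsTopDiagram w 𝒯) ∧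
    ∀ 𝒯 : BubblingDiagram n n, IsTopDiagram w 𝒯 →
      ∀ 𝒟 ∈ bubblingDiagrams w, ∃ 𝒟' ∈ bubblingDiagrams w,
        𝒟'.F = 𝒯.F ∧
        (MvPolynomial.monomial 𝒟.wt (1 : ℤ)) ∣ (MvPolynomial.monomial 𝒟'.wt (1 : ℤ)) := by
  refine ⟨?_, fun 𝒯 h𝒯 𝒟 h𝒟 => ?_⟩
  · obtain ⟨𝒯, h𝒯⟩ := exists_isTopDiagram w
    exact ⟨𝒯, h𝒯, fun 𝒯' h => h.represents.unique h𝒯.represents⟩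
  have hr₀ := represents_rotheBubblingDiagram w
  obtain ⟨q, F, hc, hr⟩ := hr₀.exists_of_mem_BD (isConfig_levelRow w) h𝒟
  -- The transformation takes place among configurations and need not follow moves; reachability of
  -- the result is recovered afterwards.
  obtain ⟨q', F', hc', hfull, hle⟩ := hc.exists_all_full (levelRow_strictMono w)
    (distinguishedLevels w) fun B j m R => hw.isGreedyStep
  obtain ⟨𝒟', h𝒟', hr'⟩ :=
    BubblingDiagram.exists_mem_BD_represents hr₀ (levelRow_strictMono w) hc'
  refine ⟨𝒟', h𝒟', ?_, ?_⟩
  · ext ⟨i, j⟩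
    rw [hr'.mem_F, h𝒯.represents.mem_F]
    exact exists_congr fun l => hc'.dead_iff hfull j l i
  · rw [MvPolynomial.monomial_dvd_monomial]
    refine ⟨Or.inr fun i => ?_, one_dvd _⟩
    rw [hr.wt_apply, hr'.wt_apply]
    exact hle i i.2
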